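/- **Definitions.** Let $d\ge 1$. A (homogeneous) Poisson process of intensity $\lambda>0$ on $\mathbb R^d$ is a random set $L\subseteq\mathbb R^d$ such that the number of points of $L$ in each Borel set $A$ of finite volume has the Poisson distribution with mean $\lambda\,\mathrm{vol}(A)$, and the numbers of points in disjoint such sets are independent. *$k$-stone colored friendly frogs* on a set $L\subseteq\mathbb R^d$ is the following game. Alice first places an amber frog on a point of $L$; Bob then places a blue frog on a different point of $L$; after that, starting with Alice, the players alternately move their own frog (Alice the amber one, Bob the blue one) to a point of $L$ that is not occupied by the other frog, in such a way that the Euclidean distance between the two frogs strictly decreases. Moreover, immediately after each placing or moving of a frog, the player puts $k$ stones on any $k$ distinct points of $L$ (removing the stones that were there before); the other player may not place or move their frog onto any of these $k$ points in the next turn. A player who cannot make a legal move on their turn loses. A strategy for a player assigns a legal move, if one exists, to each position in which it is that player's turn. The game is a win for Bob if Bob has a strategy with which, whatever strategy Alice uses, the game ends after finitely many moves with Alice unable to move. For $m\ge1$, an *$m$-matching* of $L$ is a set of unordered pairs of distinct points of $L$ such that each point of $L$ belongs to at most $m$ pairs; it is *perfect* if each point of $L$ belongs to exactly $m$ pairs.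 The partners of $x$ are the points paired with $x$; $D(x)$ is the distance from $x$ to its most distant partner, with $D(x)=\infty$ if $x$ has fewer than $m$ partners. An $m$-matching is *stable* if there are no distinct $x,y\in L$, not matched to each other, with $|x-y|<D(x)$ and $|x-y|<D(y)$. **Theorem.** Let $d\ge 1$, let $L$ be a Poisson process of intensity $\lambda>0$ on $\mathbb R^d$, and let $k\ge 1$. With probability $1$, $k$-stone colored friendly frogs on $L$ is a win for Bob. Moreover, with probability $1$, $L$ has exactly one stable $(k+1)$-matching, and this matching is perfect. -/

import Mathlib

open MeasureTheory ProbabilityTheory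
open scoped NNReal ENNReal

namespace FriendlyFrogs

/-! ### Poisson point processes -/

/-- The random set `L` is a homogeneous Poisson point process of intensity `r` on `ℝ^d`: the number
of points of `L` in a Borel set `A` of finite volume has the Poisson distribution with mean
`r * volume A`, and the numbers of points in finitely many pairwise disjoint such sets are
independent. -/
structure IsPoissonProcess {d : ℕ} {Ω : Type*} [MeasurableSpace Ω] (P : Measure Ω) (r : ℝ≥0)
    (L : Ω → Set (EuclideanSpace ℝ (Fin d))) : Prop where
  hasLaw_count : ∀ A : Set (EuclideanSpace ℝ (Fin d)), MeasurableSet A → volume A ≠ ∞ →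
    HasLaw (fun ω => (L ω ∩ A).encard)
      ((poissonMeasure (r * (volume A).toNNReal)).map (fun n : ℕ => (n : ℕ∞))) P
  indep_count : ∀ (n : ℕ) (A : Fin n → Set (EuclideanSpace ℝ (Fin d))),
    (∀ i, MeasurableSet (A i)) → (∀ i, volume (A i) ≠ ∞) →
    Pairwise (fun i j => Disjoint (A i) (A j)) →
    iIndepFun (fun i ω => (L ω ∩ A i).encard) P

/-! ### The game of `k`-stone colored friendly frogs -/

inductive Player
  | alice
  | bob

/-- A position of the game. `empty` is the initial position, with Alice about to place the amber
frog; in `amberOnly a S` the amber frog is at `a`, the stones occupy `S`, and Bob is about to place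
the blue frog; in `both i a b S` the amber frog is at `a`, the blue frog at `b`, the stones placed
by the previous player occupy `S`, and it is the turn of player `i`. -/
inductive Position (E : Type*)
  | empty
  | amberOnly (a : E) (S : Finset E)
  | both (i : Player) (a b : E) (S : Finset E)

/-- The player whose turn it is. -/
def Position.toMove {E : Type*} : Position E → Player
  | .empty => .alice
  | .amberOnly _ _ => .bob
  | .both i _ _ _ => i

variable {E : Type*} [MetricSpace E]

/-- `Move L k p q`: it is legal to go from the position `p` to the position `q` in one turn of
`k`-stone colored friendly frogs on the set `L`. In a turn the player places (opening) or moves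
(afterwards) their own frog to a point of `L` which does not carry a stone and is not occupied by
the other frog, strictly decreasing the distance between the frogs if both are already present,
and then puts the `k` stones on any `k` points of `L`. -/
inductive Move (L : Set E) (k : ℕ) : Position E → Position E → Prop
  | placeAmber {a : E} {S : Finset E} (ha : a ∈ L) (hS : (S : Set E) ⊆ L) (hk : S.card = k) :
      Move L k .empty (.amberOnly a S)
  | placeBlue {a b : E} {S S' : Finset E} (hb : b ∈ L) (hab : b ≠ a) (hbS : b ∉ S)
      (hS' : (S' : Set E) ⊆ L) (hk : S'.card = k) :
      Move L k (.amberOnly a S) (.both .alice a b S')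
  | moveAmber {a a' b : E} {S S' : Finset E} (ha' : a' ∈ L) (hab : a' ≠ b) (haS : a' ∉ S)
      (hlt : dist a' b < dist a b) (hS' : (S' : Set E) ⊆ L) (hk : S'.card = k) :
      Move L k (.both .alice a b S) (.both .bob a' b S')
  | moveBlue {a b b' : E} {S S' : Finset E} (hb' : b' ∈ L) (hab : b' ≠ a) (hbS : b' ∉ S)
      (hlt : dist a b' < dist a b) (hS' : (S' : Set E) ⊆ L) (hk : S'.card = k) :
      Move L k (.both .bob a b S) (.both .alice a b' S')

/-- A strategy for player `i` assigns to each position in which it is the turn of `i` a position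
reached by a legal move, if there is a legal move. (Its other values are irrelevant.) -/
def IsStrategy (L : Set E) (k : ℕ) (i : Player) (σ : Position E → Position E) : Prop :=
  ∀ p, p.toMove = i → (∃ q, Move L k p q) → Move L k p (σ p)

/-- The successive positions when Alice follows `σ` and Bob follows `τ`. (Values after the first
position without a legal move are irrelevant.) -/
def play {E : Type*} (σ τ : Position E → Position E) : ℕ → Position E
  | 0 => .empty
  | n + 1 =>
    match (play σ τ n).toMove with
    | .alice => σ (play σ τ n)
    | .bob => τ (play σ τ n)

/-- When Alice follows `σ` and Bob follows `τ`, the game ends after finitely many legal moves in a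
position in which it is the turn of player `i`, who cannot move: player `i` loses. -/
def LosesPlay (L : Set E) (k : ℕ) (i : Player) (σ τ : Position E → Position E) : Prop :=
  ∃ n : ℕ, (∀ m < n, Move L k (play σ τ m) (play σ τ (m + 1))) ∧
    (∀ q, ¬ Move L k (play σ τ n) q) ∧ (play σ τ n).toMove = i

/-- The game is a win for Bob: Bob has a winning strategy, that is, a strategy `τ` that results in
Alice losing, whatever strategy `σ` Alice uses. -/
def IsWinForBob (L : Set E) (k : ℕ) : Prop :=
  ∃ τ, IsStrategy L k .bob τ ∧ ∀ σ, IsStrategy L k .alice σ → LosesPlay L k .alice σ τ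

/-! ### Stable multi-matchings -/

/-- An `m`-matching of `L`: a set of unordered pairs of distinct points of `L` (the edges of the
graph `M`) such that each point belongs to at most `m` pairs. -/
def IsMultiMatching (L : Set E) (m : ℕ) (M : SimpleGraph E) : Prop :=
  (∀ x y, M.Adj x y → x ∈ L ∧ y ∈ L) ∧ ∀ x ∈ L, (M.neighborSet x).encard ≤ m

/-- The `m`-matching `M` of `L` is perfect: each point of `L` has exactly `m` partners. -/
def IsPerfect (L : Set E) (m : ℕ) (M : SimpleGraph E) : Prop :=
  ∀ x ∈ L, (M.neighborSet x).encard = m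

open Classical in
/-- The distance `D(x)` from `x` to its most distant partner, with `D(x) = ∞` if `x` has strictly
fewer than `m` partners. -/
noncomputable def farthest (m : ℕ) (M : SimpleGraph E) (x : E) : ℝ≥0∞ :=
  if (M.neighborSet x).encard < m then ∞ else ⨆ y ∈ M.neighborSet x, edist x y

/-- `M` is a stable `m`-matching of `L`: an `m`-matching such that no two distinct points `x`, `y`
of `L` that are not matched to each other satisfy `|x - y| < D(x)` and `|x - y| < D(y)`. -/
def IsStableMultiMatching (L : Set E) (m : ℕ) (M : SimpleGraph E) : Prop :=
  IsMultiMatching L m M ∧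
    ∀ x ∈ L, ∀ y ∈ L, x ≠ y → ¬ M.Adj x y →
      ¬ (edist x y < farthest m M x ∧ edist x y < farthest m M y)

end FriendlyFrogs

/-!
The proof compares the game with the stable `(k + 1)`-matching of `L`.

**Matching.** Call `L` *generic* (`IsGeneric`) if it is locally finite, no point of `L` has the same
distance to two other points of `L`, and there is no infinite sequence of pairs of points of `L`
with strictly decreasing distances in which consecutive pairs share a point. For generic `L`, a
graph is a stable `m`-matching if and only if it is *greedy* (`IsGreedy`): `x` and `y` are matched
exactly when each of them has fewer than `m` partners that are closer to it than the other one is.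
This is a recursion along shorter adjacent pairs, which is well founded, so there is exactly one
stable `m`-matching (`IsGeneric.existsUnique_stable`).

**Game.** If the stable `(k + 1)`-matching is perfect, Bob always moves his frog to a partner `b` of
Alice's point `a`, and puts his stones on the other `k` partners of `b`. If Alice moves to `a'`,
then `a'` and `b` are not matched although `a'` is closer to `b` than the partner `a` is. By
stability `a'` has `k + 1` partners closer than `b`, and Alice's `k` stones leave one of them free
(`isWinForBob_of_isPerfect`). Play is finite because the successive pairs of frog positions form a
descending sequence, and these are finite for generic `L`.

**Genericity.** All probabilities are computed on the grid of mesh `2⁻ʲ`, where the indicators of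
the occupied cells form a field of independent, identically distributed variables, and `j` tends to
infinity. The lengths in an infinite decreasing sequence converge, so all but finitely many of them
lie in an interval so short that the annuli with these radii contain at most half a point on
average. The expected number of self-avoiding paths of `n` such steps from a bounded region
is `O(2⁻ⁿ)`, so the paths from any given point have bounded length, and the sequence stays in a
bounded region, which contradicts local finiteness (`wellFounded_desc`,
`IsPoissonProcess.exists_ae_no_long_path`).

**Perfectness.** Any two points that both have fewer than `m` partners within distance `K`, and
whose own distance is less than `K`, are matched to each other. Hence of `n` disjoint translates of
a unit cube, at most `m + 1` contain a point with fewer than `m` partners within distance `K`, if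
`K` is large.
By stationarity the probability that a given cube contains a point with fewer than `m` partners is
at most `(m + 1) / n`, for every `n` (`IsPoissonProcess.mul_measure_deficient_le`). To make this
precise, the greedy recursion is truncated at depth `t` and run on the set of occupied cells
(`truncAdj`): the resulting events are measurable functions of the occupation field, whose law is
shift invariant, and around each pair of points of `L` the truncated recursion agrees with the
matching as soon as `j` and `t` are large (`IsApprox.eventually_truncAdj_iff`).
-/

namespace FriendlyFrogs

open Set Filter Topology

/-! ### The greedy description of stable matchings -/

section Matching

variable {E : Type*} [MetricSpace E]

/-- The pair `q` of points of `L` is a possible successor of the pair `p` in a descending sequence: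
it shares a point with `p`, and its points are closer to each other. Pairs are ordered, but the
relation is insensitive to the order. -/
def Desc (L : Set E) (q p : E × E) : Prop :=
  q.1 ∈ L ∧ q.2 ∈ L ∧ dist q.1 q.2 < dist p.1 p.2 ∧
    (q.1 = p.1 ∨ q.1 = p.2 ∨ q.2 = p.1 ∨ q.2 = p.2)

/-- The almost sure properties of a Poisson configuration that the deterministic part of the
argument needs: local finiteness, no point with the same distance to two others, and no infinite
descending sequence of pairs. -/
structure IsGeneric (L : Set E) : Prop where
  finite_ball : ∀ (x : E) (R : ℝ), (L ∩ Metric.closedBall x R).Finite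
  scalene : ∀ x ∈ L, ∀ y ∈ L, ∀ z ∈ L, y ≠ z → dist x y ≠ dist x z
  wf : WellFounded (Desc L)

/-- The `A`-partners of `x` that are closer to `x` than `y` is. -/
def closer (A : E → E → Prop) (x y : E) : Set E := {z | A x z ∧ dist x z < dist x y}

/-- The relation `A` solves the greedy recursion: two distinct points of `L` are related if and only
if neither has `m` partners closer than the other. The right-hand side involves only the values of
`A` on pairs that precede `(x, y)` for `Desc L`, so `A` is determined if `Desc L` is well
founded. -/
def IsGreedy (L : Set E) (m : ℕ) (A : E → E → Prop) : Prop :=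
  ∀ x y, A x y ↔ x ∈ L ∧ y ∈ L ∧ x ≠ y ∧ (closer A x y).encard < m ∧ (closer A y x).encard < m

theorem IsGreedy.symm {L : Set E} {m : ℕ} {A : E → E → Prop} (h : IsGreedy L m A) {x y : E}
    (hxy : A x y) : A y x := by
  rw [h] at hxy ⊢
  tauto

theorem exists_isGreedy {L : Set E} (wf : WellFounded (Desc L)) (m : ℕ) :
    ∃ A, IsGreedy L m A := by
  let F : ∀ p : E × E, (∀ q, Desc L q p → Prop) → Prop := fun p ih =>
    p.1 ∈ L ∧ p.2 ∈ L ∧ p.1 ≠ p.2 ∧ {z | ∃ h : Desc L (p.1, z) p, ih (p.1, z) h}.encard < m ∧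
      {z | ∃ h : Desc L (p.2, z) p, ih (p.2, z) h}.encard < m
  have hF : ∀ x y, wf.fix F (x, y) ↔ x ∈ L ∧ y ∈ L ∧ x ≠ y ∧
      {z | Desc L (x, z) (x, y) ∧ wf.fix F (x, z)}.encard < m ∧
      {z | Desc L (y, z) (x, y) ∧ wf.fix F (y, z)}.encard < m := by
    intro x y
    rw [wf.fix_eq]
    simp only [F, exists_prop]
  refine ⟨fun x y => wf.fix F (x, y), fun x y => ?_⟩
  have key : ∀ x y z, wf.fix F (x, z) ∧ dist x z < dist x y ↔
      dist x z < dist x y ∧ x ∈ L ∧ z ∈ L ∧ wf.fix F (x, z) := by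
    intro x y z
    refine ⟨fun h => ⟨h.2, ((hF _ _).1 h.1).1, ((hF _ _).1 h.1).2.1, h.1⟩, fun h => ⟨h.2.2.2, h.1⟩⟩
  have e1 : closer (fun x y => wf.fix F (x, y)) x y =
      {z | Desc L (x, z) (x, y) ∧ wf.fix F (x, z)} := by
    ext z
    simp only [closer, mem_ofPred_eq, key, Desc]
    tauto
  have e2 : closer (fun x y => wf.fix F (x, y)) y x =
      {z | Desc L (y, z) (x, y) ∧ wf.fix F (y, z)} := by
    ext z
    simp only [closer, mem_ofPred_eq, key, Desc, dist_comm x y]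
    tauto
  rw [e1, e2]
  exact hF x y

theorem IsGreedy.unique {L : Set E} (wf : WellFounded (Desc L)) {m : ℕ} {A B : E → E → Prop}
    (hA : IsGreedy L m A) (hB : IsGreedy L m B) (x y : E) : A x y ↔ B x y := by
  suffices H : ∀ p : E × E, A p.1 p.2 ↔ B p.1 p.2 from H (x, y)
  intro p
  induction p using wf.induction with
  | _ p ih =>
  obtain ⟨x, y⟩ := p
  have key : ∀ u v, (u = x ∧ v = y ∨ u = y ∧ v = x) → u ∈ L → closer A u v = closer B u v := by
    intro u v huv hu
    have hd : dist u v = dist x y := by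
      rcases huv with ⟨rfl, rfl⟩ | ⟨rfl, rfl⟩
      · rfl
      · exact dist_comm _ _
    have aux : ∀ z, z ∈ L → dist u z < dist u v → (A u z ↔ B u z) := fun z hz h =>
      ih (u, z) ⟨hu, hz, by simpa [hd] using h, by rcases huv with h | h <;> simp [h.1]⟩
    ext z
    constructor
    · rintro ⟨h1, h2⟩
      exact ⟨(aux z ((hA _ _).1 h1).2.1 h2).1 h1, h2⟩
    · rintro ⟨h1, h2⟩
      exact ⟨(aux z ((hB _ _).1 h1).2.1 h2).2 h1, h2⟩
  rw [hA x y, hB x y]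
  refine and_congr_right fun hx => and_congr_right fun hy => ?_
  rw [key x y (by simp) hx, key y x (by simp) hy]

theorem IsStableMultiMatching.isGreedy {L : Set E} (hL : IsGeneric L) {m : ℕ} {M : SimpleGraph E}
    (hM : IsStableMultiMatching L m M) : IsGreedy L m M.Adj := by
  obtain ⟨⟨hML, hMm⟩, hst⟩ := hM
  -- A partner `y` of `x` is among the at most `m` partners of `x`, but not closer than itself.
  have half : ∀ x y, M.Adj x y → (closer M.Adj x y).encard < m := by
    intro x y h
    have hx := (hML x y h).1
    have hfin : (M.neighborSet x).Finite :=
      Set.finite_of_encard_le_coe (hMm x hx)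
    refine lt_of_lt_of_le (hfin.subset ?_ |>.encard_lt_encard ?_) (hMm x hx)
    · exact fun z hz => hz.1
    · refine ⟨fun z hz => hz.1, fun hsub => ?_⟩
      exact lt_irrefl _ (hsub (show y ∈ M.neighborSet x from h)).2
  -- If `x` has fewer than `m` partners closer than a non-partner `y`, then `|x - y| < D(x)`.
  have half' : ∀ x ∈ L, ∀ y ∈ L, ¬ M.Adj x y → (closer M.Adj x y).encard < m →
      edist x y < farthest m M x := by
    intro x hx y hy hadj hlt
    by_contra hcon
    unfold farthest at hcon
    split_ifs at hcon with hc
    · exact hcon (edist_lt_top x y)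
    · refine hc (lt_of_le_of_lt (encard_le_encard
        (show M.neighborSet x ⊆ closer M.Adj x y from fun z hz => ⟨hz, ?_⟩)) hlt)
      have hz' : M.Adj x z := hz
      have h1 : edist x z ≤ edist x y :=
        (le_iSup₂ (f := fun y (_ : y ∈ M.neighborSet x) => edist x y) z hz).trans (not_lt.1 hcon)
      have h2 : dist x z ≤ dist x y := by
        rwa [edist_dist, edist_dist, ENNReal.ofReal_le_ofReal_iff dist_nonneg] at h1
      refine lt_of_le_of_ne h2 (hL.scalene x hx z (hML x z hz').2 y hy ?_)
      rintro rfl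
      exact hadj hz'
  intro x y
  constructor
  · intro h
    exact ⟨(hML x y h).1, (hML x y h).2, h.ne, half x y h, half y x h.symm⟩
  · rintro ⟨hx, hy, hne, h1, h2⟩
    by_contra hadj
    refine hst x hx y hy hne hadj ⟨half' x hx y hy hadj h1, ?_⟩
    rw [edist_comm]
    exact half' y hy x hx (fun h => hadj h.symm) h2

/-- A solution of the greedy recursion, as a graph. -/
def IsGreedy.graph {L : Set E} {m : ℕ} {A : E → E → Prop} (hA : IsGreedy L m A) :
    SimpleGraph E where
  Adj := A
  symm := ⟨fun _ _ h => hA.symm h⟩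
  loopless := ⟨fun x h => ((hA x x).1 h).2.2.1 rfl⟩

/-- Among `m + 1` partners of `x`, the most distant one would have `m` closer competitors. -/
theorem IsGreedy.encard_le {L : Set E} (hL : IsGeneric L) {m : ℕ} {A : E → E → Prop}
    (hA : IsGreedy L m A) (x : E) : {y | A x y}.encard ≤ m := by
  by_contra hcon
  obtain ⟨t, hts, htc⟩ := Set.exists_subset_encard_eq
    (Order.add_one_le_of_lt (not_le.1 hcon))
  have htfin : t.Finite := Set.finite_of_encard_eq_coe (k := m + 1) (by rw [htc]; rfl)
  have htne : t.Nonempty := by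
    rw [Set.nonempty_iff_ne_empty]
    rintro rfl
    rw [Set.encard_empty] at htc
    exact absurd htc (by exact_mod_cast (Nat.succ_ne_zero m).symm)
  obtain ⟨y, hyt, hy⟩ := Set.exists_max_image t (fun y => dist x y) htfin htne
  have hAy : A x y := hts hyt
  obtain ⟨hxL, hyL, -, hlt, -⟩ := (hA x y).1 hAy
  have hsub : t \ {y} ⊆ closer A x y := by
    rintro z ⟨hz, hzy⟩
    have hAz : A x z := hts hz
    exact ⟨hAz, lt_of_le_of_ne (hy z hz)
      (hL.scalene x hxL z ((hA x z).1 hAz).2.1 y hyL hzy)⟩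
  have h1 := Set.encard_sdiff_singleton_add_one hyt
  rw [htc] at h1
  have h2 : (t \ {y}).encard = m := by
    exact (ENat.add_left_injective_of_ne_top (by simp : (1 : ℕ∞) ≠ ⊤)) h1
  exact absurd (lt_of_le_of_lt (encard_le_encard hsub) hlt) (by rw [h2]; exact lt_irrefl _)

theorem IsGreedy.encard_closer_of_not {L : Set E} {m : ℕ} {A : E → E → Prop}
    (hA : IsGreedy L m A) {x y : E} (hx : x ∈ L) (hy : y ∈ L) (hne : x ≠ y) (h : ¬ A x y) :
    (m : ℕ∞) ≤ (closer A x y).encard ∨ (m : ℕ∞) ≤ (closer A y x).encard := by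
  by_contra! hcon
  exact h ((hA x y).2 ⟨hx, hy, hne, hcon.1, hcon.2⟩)

theorem IsGreedy.isStableMultiMatching {L : Set E} (hL : IsGeneric L) {m : ℕ} {A : E → E → Prop}
    (hA : IsGreedy L m A) : IsStableMultiMatching L m hA.graph := by
  refine ⟨⟨fun x y h => ⟨((hA x y).1 h).1, ((hA x y).1 h).2.1⟩, fun x _ => hA.encard_le hL x⟩, ?_⟩
  -- If `x` has `m` partners closer than `y`, these are all its partners, so `D(x) ≤ |x - y|`.
  have key : ∀ x y, (m : ℕ∞) ≤ (closer A x y).encard → farthest m hA.graph x ≤ edist x y := by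
    intro x y h
    have hfin : {y | A x y}.Finite := Set.finite_of_encard_le_coe (hA.encard_le hL x)
    have heq : closer A x y = {y | A x y} :=
      (hfin.subset fun z hz => hz.1).eq_of_subset_of_encard_le (fun z hz => hz.1)
        ((hA.encard_le hL x).trans h)
    have hnlt : ¬ (hA.graph.neighborSet x).encard < m := by
      refine not_lt.2 (h.trans ?_)
      rw [heq]
      exact le_rfl
    rw [farthest, if_neg hnlt]
    refine iSup₂_le fun z hz => ?_
    have hz' : z ∈ closer A x y := by rw [heq]; exact hz
    rw [edist_dist, edist_dist]
    exact ENNReal.ofReal_le_ofReal hz'.2.le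
  rintro x hx y hy hne hadj ⟨h1, h2⟩
  rcases hA.encard_closer_of_not hx hy hne hadj with h | h
  · exact not_lt.2 (key x y h) h1
  · rw [edist_comm] at h2
    exact not_lt.2 (key y x h) h2

theorem IsGeneric.existsUnique_stable {L : Set E} (hL : IsGeneric L) (m : ℕ) :
    ∃! M : SimpleGraph E, IsStableMultiMatching L m M := by
  obtain ⟨A, hA⟩ := exists_isGreedy hL.wf m
  refine ⟨hA.graph, hA.isStableMultiMatching hL, fun M hM => ?_⟩
  ext x y
  exact (hM.isGreedy hL).unique hL.wf hA x y

end Matching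

/-! ### Bob's strategy -/

section Game

variable {E : Type*} [MetricSpace E]

/-- The positions that Bob aims for: Alice is to move, the frogs are at matched points, and all
partners of Bob's point other than Alice's carry stones. -/
inductive BobGood (M : SimpleGraph E) : Position E → Prop
  | mk {a b : E} {S : Finset E} (hab : M.Adj a b) (hS : ∀ c, M.Adj b c → c ≠ a → c ∈ S) :
      BobGood M (.both .alice a b S)

/-- In a perfect `(k + 1)`-matching, `k` stones exactly cover the partners of `b` other than `a`. -/
theorem IsGreedy.exists_stones {L : Set E} {k : ℕ} {M : SimpleGraph E}
    (hM : IsGreedy L (k + 1) M.Adj) (hperf : IsPerfect L (k + 1) M) {a b : E} (hab : M.Adj a b) :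
    ∃ S : Finset E, (S : Set E) ⊆ L ∧ S.card = k ∧ ∀ c, M.Adj b c → c ≠ a → c ∈ S := by
  have hb : b ∈ L := ((hM a b).1 hab).2.1
  have h1 := hperf b hb
  have h2 := Set.encard_sdiff_singleton_add_one (show a ∈ M.neighborSet b from hab.symm)
  have h3 : (M.neighborSet b \ {a}).encard = k := by
    rw [h1] at h2
    refine (ENat.add_left_injective_of_ne_top (by simp : (1 : ℕ∞) ≠ ⊤)) ?_
    simpa using h2
  have hfin := Set.finite_of_encard_eq_coe h3
  refine ⟨hfin.toFinset, ?_, ?_, ?_⟩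
  · intro c hc
    rw [hfin.coe_toFinset] at hc
    exact ((hM b c).1 hc.1).2.1
  · rw [hfin.encard_eq_coe_toFinset_card] at h3
    exact_mod_cast h3
  · intro c hc hca
    rw [hfin.mem_toFinset]
    exact ⟨hc, hca⟩

theorem exists_mem_not_mem_of_card {E : Type*} {s : Set E} {k : ℕ} {S : Finset E}
    (hs : (k : ℕ∞) < s.encard) (hS : S.card = k) : ∃ b ∈ s, b ∉ S := by
  by_contra! h
  have := encard_le_encard (show s ⊆ (S : Set E) from fun b hb => h b hb)
  rw [Set.encard_coe_eq_coe_finsetCard, hS] at this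
  exact absurd hs (not_lt.2 this)

theorem isWinForBob_of_isPerfect {L : Set E} (hL : IsGeneric L) {k : ℕ} {M : SimpleGraph E}
    (hst : IsStableMultiMatching L (k + 1) M) (hperf : IsPerfect L (k + 1) M) :
    IsWinForBob L k := by
  classical
  have hM := hst.isGreedy hL
  let τ : Position E → Position E := fun p =>
    if h : ∃ q, Move L k p q ∧ BobGood M q then h.choose
    else if h : ∃ q, Move L k p q then h.choose else p
  have hτ : ∀ p, (∃ q, Move L k p q ∧ BobGood M q) → Move L k p (τ p) ∧ BobGood M (τ p) := by
    intro p h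
    simp only [τ, dif_pos h]
    exact h.choose_spec
  have hτ' : IsStrategy L k .bob τ := by
    intro p _ h
    by_cases h' : ∃ q, Move L k p q ∧ BobGood M q
    · exact (hτ p h').1
    · simp only [τ, dif_neg h', dif_pos h]
      exact h.choose_spec
  refine ⟨τ, hτ', fun σ hσ => ?_⟩
  have hopen : ∀ (a : E) (S : Finset E), a ∈ L → S.card = k →
      ∃ q, Move L k (.amberOnly a S) q ∧ BobGood M q := by
    intro a S ha hS
    obtain ⟨b, hb, hbS⟩ := exists_mem_not_mem_of_card (s := M.neighborSet a) (k := k)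
      (by rw [hperf a ha]; exact_mod_cast Nat.lt_succ_self k) hS
    have hab : M.Adj a b := hb
    obtain ⟨S', hS'L, hS'k, hS'⟩ := hM.exists_stones hperf hab
    exact ⟨_, .placeBlue ((hM a b).1 hab).2.1 hab.ne.symm hbS hS'L hS'k, .mk hab hS'⟩
  have hreply : ∀ (a b : E) (S : Finset E) (a' : E) (S' : Finset E),
      M.Adj a b → (∀ c, M.Adj b c → c ≠ a → c ∈ S) → a' ∈ L → a' ≠ b → a' ∉ S →
      dist a' b < dist a b → S'.card = k →
      ∃ q, Move L k (.both .bob a' b S') q ∧ BobGood M q := by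
    intro a b S a' S' hab hS ha' hne haS hlt hk
    have hb : b ∈ L := ((hM a b).1 hab).2.1
    have hnadj : ¬ M.Adj b a' := by
      intro h
      refine haS (hS a' h ?_)
      rintro rfl
      exact lt_irrefl _ hlt
    -- Since `b` has fewer than `k + 1` partners closer than `a`, and `a'` is closer to `b` than
    -- `a`, it is `a'` that has `k + 1` partners closer than `b`.
    have hcl : ((k + 1 : ℕ) : ℕ∞) ≤ (closer M.Adj a' b).encard := by
      rcases hM.encard_closer_of_not hb ha' hne.symm hnadj with h | h
      · have h2 := ((hM a b).1 hab).2.2.2.2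
        refine absurd (lt_of_le_of_lt (h.trans (encard_le_encard
          (show closer M.Adj b a' ⊆ closer M.Adj b a from fun z hz => ⟨hz.1, ?_⟩))) h2)
          (lt_irrefl _)
        have h3 := hz.2
        rw [dist_comm b a'] at h3
        rw [dist_comm b a]
        exact h3.trans hlt
      · exact h
    obtain ⟨b', hb', hb'S⟩ := exists_mem_not_mem_of_card (k := k)
      (lt_of_lt_of_le (by exact_mod_cast Nat.lt_succ_self k) hcl) hk
    obtain ⟨hadj, hlt'⟩ := hb'
    obtain ⟨S'', h1, h2, h3⟩ := hM.exists_stones hperf hadj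
    exact ⟨_, .moveBlue ((hM a' b').1 hadj).2.1 hadj.ne.symm hb'S hlt' h1 h2, .mk hadj h3⟩
  have hA : ∀ n, (play σ τ n).toMove = .alice → play σ τ (n + 1) = σ (play σ τ n) := by
    intro n hn
    simp [play, hn]
  have hB : ∀ n, (play σ τ n).toMove = .bob → play σ τ (n + 1) = τ (play σ τ n) := by
    intro n hn
    simp [play, hn]
  -- Two consecutive moves go down twice in `Desc L`, hence the induction on its transitive closure.
  have main : ∀ p : E × E, ∀ n S, play σ τ n = .both .alice p.1 p.2 S →
      BobGood M (play σ τ n) → (∀ m < n, Move L k (play σ τ m) (play σ τ (m + 1))) →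
      LosesPlay L k .alice σ τ := by
    intro p
    induction p using hL.wf.transGen.induction with
    | _ p ih =>
    obtain ⟨a, b⟩ := p
    intro n S hn hgood hmoves
    have hturn : (play σ τ n).toMove = .alice := by rw [hn]; rfl
    by_cases hmv : ∃ q, Move L k (play σ τ n) q
    · have hm1 := hσ _ hturn hmv
      rw [← hA n hturn] at hm1
      have hm1' := hm1
      rw [hn] at hm1 hgood
      cases hgood with
      | mk hab hS =>
      generalize hq : play σ τ (n + 1) = q at hm1
      cases hm1 with
      | @moveAmber _ a' _ _ S' ha' hne haS hlt hS' hk =>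
      have hturn' : (play σ τ (n + 1)).toMove = .bob := by rw [hq]; rfl
      obtain ⟨hm2, hg2⟩ := hτ _ (hreply a b S a' S' hab hS ha' hne haS hlt hk)
      rw [← hq, ← hB (n + 1) hturn'] at hm2 hg2
      have hm2' := hm2
      have hg2' := hg2
      rw [hq] at hm2
      generalize hq' : play σ τ (n + 1 + 1) = q' at hm2
      cases hm2 with
      | @moveBlue _ _ b' _ S'' hb' hne' hbS' hlt' hS'' hk' =>
      refine ih (a', b') ?_ (n + 1 + 1) S'' hq' hg2' ?_
      · have hb : b ∈ L := ((hM a b).1 hab).2.1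
        refine Relation.TransGen.tail (b := (a', b)) (.single ⟨ha', hb', hlt', by simp⟩)
          ⟨ha', hb, hlt, by simp⟩
      · intro i hi
        rcases Nat.lt_succ_iff_lt_or_eq.1 hi with hi | rfl
        · rcases Nat.lt_succ_iff_lt_or_eq.1 hi with hi | rfl
          · exact hmoves i hi
          · exact hm1'
        · exact hm2'
    · exact ⟨n, hmoves, fun q hq => hmv ⟨q, hq⟩, hturn⟩
  by_cases h0 : ∃ q, Move L k (.empty : Position E) q
  · have hm0 : Move L k (play σ τ 0) (play σ τ 1) := hσ _ rfl h0
    have hm0' := hm0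
    change Move L k .empty _ at hm0
    generalize hq : play σ τ 1 = q at hm0
    cases hm0 with
    | @placeAmber a S ha hS hk =>
    have hturn : (play σ τ 1).toMove = .bob := by rw [hq]; rfl
    obtain ⟨hm1, hg1⟩ := hτ _ (hopen a S ha hk)
    rw [← hq, ← hB 1 hturn] at hm1 hg1
    have hm1' := hm1
    rw [hq] at hm1
    generalize hq' : play σ τ (1 + 1) = q' at hm1
    cases hm1 with
    | @placeBlue _ b _ S' hb hab hbS hS' hk' =>
    refine main (a, b) 2 S' hq' hg1 ?_
    intro i hi
    interval_cases i
    · exact hm0'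
    · exact hm1'
  · exact ⟨0, by simp, fun q hq => h0 ⟨q, hq⟩, rfl⟩

end Game

/-! ### Finite-depth approximations of the greedy matching -/

section Approximation

/-- The greedy recursion of `IsGreedy` on the point set `O` with distance function `ρ`, stopped
after `t` steps. At depth `0` no pair is matched. -/
def truncAdj {X : Type*} (ρ : X → X → ℝ) (m : ℕ) (O : Set X) : ℕ → X → X → Prop
  | 0, _, _ => False
  | t + 1, x, y => x ∈ O ∧ y ∈ O ∧ x ≠ y ∧
      {z | truncAdj ρ m O t x z ∧ ρ x z < ρ x y}.encard < m ∧
      {z | truncAdj ρ m O t y z ∧ ρ y z < ρ y x}.encard < m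

theorem truncAdj.mem_right {X : Type*} {ρ : X → X → ℝ} {m : ℕ} {O : Set X} {t : ℕ} {x y : X}
    (h : truncAdj ρ m O t x y) : y ∈ O := by
  cases t with
  | zero => exact h.elim
  | succ t => exact h.2.1

theorem not_truncAdj_self {X : Type*} {ρ : X → X → ℝ} {m : ℕ} {O : Set X} {t : ℕ} {x : X} :
    ¬ truncAdj ρ m O t x x := by
  cases t with
  | zero => exact id
  | succ t => exact fun h => h.2.2.1 rfl

/-- Some point of `O` in the window `W` has fewer than `m` partners within distance `K`, in the
greedy recursion on `O` of depth `t`. -/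
def HasDeficient {X : Type*} (ρ : X → X → ℝ) (m : ℕ) (K : ℝ) (t : ℕ) (O W : Set X) : Prop :=
  ∃ w ∈ O ∩ W, {y | truncAdj ρ m O t w y ∧ ρ w y ≤ K}.encard < m

/-- The maps `κ j` from `E` to `X`, equipped with the distance functions `ρ j`, are isometries up to
errors `δ j` that tend to zero. -/
structure IsApprox {E X : Type*} [MetricSpace E] (κ : ℕ → E → X) (ρ : ℕ → X → X → ℝ)
    (δ : ℕ → ℝ) : Prop where
  tendsto : Tendsto δ atTop (𝓝 0)
  abs_sub_le : ∀ j x y, |ρ j (κ j x) (κ j y) - dist x y| ≤ δ j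

variable {E X : Type*} [MetricSpace E] {κ : ℕ → E → X} {ρ : ℕ → X → X → ℝ} {δ : ℕ → ℝ}

theorem IsApprox.tendsto_dist (h : IsApprox κ ρ δ) (x y : E) :
    Tendsto (fun j => ρ j (κ j x) (κ j y)) atTop (𝓝 (dist x y)) := by
  rw [tendsto_iff_dist_tendsto_zero]
  exact squeeze_zero (fun _ => dist_nonneg) (fun j => h.abs_sub_le j x y) h.tendsto

theorem IsApprox.eventually_ne (h : IsApprox κ ρ δ) {x y : E} (hne : x ≠ y) :
    ∀ᶠ j in atTop, κ j x ≠ κ j y := by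
  have h1 := (h.tendsto_dist x x).eventually_lt (h.tendsto_dist x y)
    (by rw [dist_self]; exact dist_pos.2 hne)
  filter_upwards [h1] with j hj heq
  rw [heq] at hj
  exact lt_irrefl _ hj

theorem IsApprox.eventually_injOn (h : IsApprox κ ρ δ) {Z : Set E} (hZ : Z.Finite) :
    ∀ᶠ j in atTop, InjOn (κ j) Z := by
  have h1 : ∀ᶠ j in atTop, ∀ x ∈ Z, ∀ y ∈ Z, x ≠ y → κ j x ≠ κ j y := by
    refine (eventually_all_finite hZ).2 fun x _ => (eventually_all_finite hZ).2 fun y _ => ?_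
    by_cases hne : x = y
    · exact Eventually.of_forall fun _ h => (h hne).elim
    · filter_upwards [h.eventually_ne hne] with j hj _ using hj
  filter_upwards [h1] with j hj x hx y hy hxy
  by_contra hne
  exact hj x hx y hy hne hxy

theorem tendsto_snd_atTop : Tendsto (Prod.snd : ℕ × ℕ → ℕ) atTop atTop := by
  rw [← prod_atTop_atTop_eq]
  exact tendsto_snd

/-- If the approximations are correct, for large depth and resolution, on all pairs `(u, z)` with
`z` closer to `u` than `v`, then they eventually give `u` the right number of partners closer than
`v`: only finitely many points compete, and genericity makes the relevant inequalities strict. -/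
theorem IsApprox.eventually_encard_truncAdj_eq (h : IsApprox κ ρ δ) {L : Set E}
    (hL : IsGeneric L) {m : ℕ} {A : E → E → Prop} (hA : IsGreedy L m A) {u v : E}
    (hu : u ∈ L) (hv : v ∈ L)
    (ih : ∀ z ∈ L, dist u z < dist u v → ∀ᶠ p : ℕ × ℕ in atTop,
      (truncAdj (ρ p.2) m (κ p.2 '' L) p.1 (κ p.2 u) (κ p.2 z) ↔ A u z)) :
    ∀ᶠ p : ℕ × ℕ in atTop,
      {w | truncAdj (ρ p.2) m (κ p.2 '' L) p.1 (κ p.2 u) w ∧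
        ρ p.2 (κ p.2 u) w < ρ p.2 (κ p.2 u) (κ p.2 v)}.encard = (closer A u v).encard := by
  set Z := L ∩ Metric.closedBall u (dist u v + 1) with hZdef
  have hZ : Z.Finite := hL.finite_ball _ _
  have hcZ : closer A u v ⊆ Z := by
    rintro z ⟨h1, h2⟩
    refine ⟨((hA u z).1 h1).2.1, ?_⟩
    rw [Metric.mem_closedBall, dist_comm]
    linarith
  have e1 : ∀ᶠ p : ℕ × ℕ in atTop, ∀ z ∈ Z,
      ((truncAdj (ρ p.2) m (κ p.2 '' L) p.1 (κ p.2 u) (κ p.2 z) ∧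
        ρ p.2 (κ p.2 u) (κ p.2 z) < ρ p.2 (κ p.2 u) (κ p.2 v)) ↔ z ∈ closer A u v) := by
    refine (eventually_all_finite hZ).2 fun z hz => ?_
    by_cases hzv : z = v
    · subst hzv
      exact Eventually.of_forall fun p => by simp [closer]
    rcases lt_or_gt_of_ne (hL.scalene u hu z hz.1 v hv hzv) with hlt | hlt
    · have h2 := tendsto_snd_atTop.eventually
        ((h.tendsto_dist u z).eventually_lt (h.tendsto_dist u v) hlt)
      filter_upwards [ih z hz.1 hlt, h2] with p hp1 hp2
      simp [closer, hp1, hp2, hlt]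
    · have h2 := tendsto_snd_atTop.eventually
        ((h.tendsto_dist u v).eventually_lt (h.tendsto_dist u z) hlt)
      filter_upwards [h2] with p hp2
      exact iff_of_false (fun hc => lt_asymm hc.2 hp2) fun hc => lt_asymm hc.2 hlt
  have e2 := tendsto_snd_atTop.eventually (h.eventually_injOn hZ)
  have e3 := tendsto_snd_atTop.eventually
    (h.tendsto.eventually_lt_const (show (0 : ℝ) < 1 / 2 by norm_num))
  filter_upwards [e1, e2, e3] with p h1 h2 h3
  rw [← (h2.mono hcZ).encard_image]
  congr 1
  ext w
  constructor
  · rintro ⟨hw, hlt⟩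
    obtain ⟨z, hz, rfl⟩ := hw.mem_right
    have hzZ : z ∈ Z := by
      refine ⟨hz, ?_⟩
      rw [Metric.mem_closedBall, dist_comm]
      have a1 := abs_le.1 (h.abs_sub_le p.2 u z)
      have a2 := abs_le.1 (h.abs_sub_le p.2 u v)
      linarith [a1.1, a2.2]
    exact ⟨z, (h1 z hzZ).1 ⟨hw, hlt⟩, rfl⟩
  · rintro ⟨z, hz, rfl⟩
    exact (h1 z (hcZ hz)).2 hz

/-- The matching status of any two points of `L` is eventually correct, as the depth `p.1` and the
resolution `p.2` tend to infinity independently of each other. The depth and the resolution are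
separated because the induction lowers the depth at a fixed resolution. -/
theorem IsApprox.eventually_truncAdj_iff (h : IsApprox κ ρ δ) {L : Set E}
    (hL : IsGeneric L) {m : ℕ} {A : E → E → Prop} (hA : IsGreedy L m A) {x y : E}
    (hx : x ∈ L) (hy : y ∈ L) :
    ∀ᶠ p : ℕ × ℕ in atTop,
      (truncAdj (ρ p.2) m (κ p.2 '' L) p.1 (κ p.2 x) (κ p.2 y) ↔ A x y) := by
  suffices H : ∀ q : E × E, q.1 ∈ L → q.2 ∈ L → ∀ᶠ p : ℕ × ℕ in atTop,
      (truncAdj (ρ p.2) m (κ p.2 '' L) p.1 (κ p.2 q.1) (κ p.2 q.2) ↔ A q.1 q.2) from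
    H (x, y) hx hy
  clear hx hy x y
  intro q
  induction q using hL.wf.induction with
  | _ q ih =>
  obtain ⟨x, y⟩ := q
  intro hx hy
  dsimp only at hx hy ⊢
  by_cases hne : x = y
  · subst hne
    refine Eventually.of_forall fun p => iff_of_false not_truncAdj_self fun hc => ?_
    exact ((hA x x).1 hc).2.2.1 rfl
  have hshift : Tendsto (fun p : ℕ × ℕ => (p.1 - 1, p.2)) atTop atTop := by
    rw [← prod_atTop_atTop_eq]
    exact (tendsto_sub_atTop_nat 1).prodMap tendsto_id
  have e1 := hshift.eventually (h.eventually_encard_truncAdj_eq hL hA hx hy fun z hz hlt =>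
    ih (x, z) ⟨hx, hz, hlt, by simp⟩ hx hz)
  have e2 := hshift.eventually (h.eventually_encard_truncAdj_eq hL hA hy hx fun z hz hlt =>
    ih (y, z) ⟨hy, hz, by simpa [dist_comm x y] using hlt, by simp⟩ hy hz)
  have e3 := tendsto_snd_atTop.eventually (h.eventually_ne hne)
  filter_upwards [e1, e2, e3, eventually_ge_atTop ((1, 0) : ℕ × ℕ)] with p h1 h2 h3 h4
  obtain ⟨t, j⟩ := p
  obtain ⟨t, rfl⟩ : ∃ s, t = s + 1 := ⟨t - 1, by have : 1 ≤ t := h4.1; omega⟩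
  simp only [Nat.add_sub_cancel] at h1 h2
  simp only [truncAdj, h1, h2]
  rw [hA x y]
  have hx' : κ j x ∈ κ j '' L := mem_image_of_mem _ hx
  have hy' : κ j y ∈ κ j '' L := mem_image_of_mem _ hy
  simp only [hx, hy, hx', hy', hne, h3, ne_eq, not_false_eq_true, true_and]

theorem tendsto_diag_atTop : Tendsto (fun j : ℕ => (j, j)) atTop atTop := by
  rw [← prod_atTop_atTop_eq]
  exact tendsto_id.prodMk tendsto_id

/-- A point with fewer than `m` partners is eventually seen by the approximations: spurious partners
within distance `K` come from finitely many points of `L`. -/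
theorem IsApprox.eventually_hasDeficient (h : IsApprox κ ρ δ) {L : Set E}
    (hL : IsGeneric L) {m : ℕ} {A : E → E → Prop} (hA : IsGreedy L m A) {B : Set E}
    {W : ℕ → Set X} (hW : ∀ j x, κ j x ∈ W j ↔ x ∈ B) (K : ℝ) {x : E} (hx : x ∈ L)
    (hxB : x ∈ B) (hdef : {y | A x y}.encard < m) :
    ∀ᶠ j in atTop, HasDeficient (ρ j) m K j (κ j '' L) (W j) := by
  set Z := L ∩ Metric.closedBall x (K + 1) with hZdef
  have hZ : Z.Finite := hL.finite_ball _ _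
  have e1 : ∀ᶠ j in atTop, ∀ z ∈ Z,
      (truncAdj (ρ j) m (κ j '' L) j (κ j x) (κ j z) ↔ A x z) :=
    (eventually_all_finite hZ).2 fun z hz =>
      tendsto_diag_atTop.eventually (h.eventually_truncAdj_iff hL hA hx hz.1)
  have e3 := h.tendsto.eventually_lt_const (show (0 : ℝ) < 1 by norm_num)
  filter_upwards [e1, e3] with j h1 h3
  refine ⟨κ j x, ⟨mem_image_of_mem _ hx, (hW j x).2 hxB⟩, ?_⟩
  refine lt_of_le_of_lt ((encard_le_encard ?_).trans (encard_image_le (κ j) {y | A x y})) hdef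
  rintro w ⟨hw, hle⟩
  obtain ⟨z, hz, rfl⟩ := hw.mem_right
  refine ⟨z, (h1 z ⟨hz, ?_⟩).1 hw, rfl⟩
  rw [Metric.mem_closedBall, dist_comm]
  have a1 := abs_le.1 (h.abs_sub_le j x z)
  linarith [a1.1]

/-- If all points of `L ∩ B` have `m` partners at distance less than `K`, the approximations
eventually see all of these. -/
theorem IsApprox.eventually_not_hasDeficient (h : IsApprox κ ρ δ) {L : Set E}
    (hL : IsGeneric L) {m : ℕ} {A : E → E → Prop} (hA : IsGreedy L m A) {B : Set E}
    {W : ℕ → Set X} (hW : ∀ j x, κ j x ∈ W j ↔ x ∈ B) (hB : Bornology.IsBounded B) {K : ℝ}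
    (hfull : ∀ x ∈ L ∩ B, (m : ℕ∞) ≤ {y | A x y ∧ dist x y < K}.encard) :
    ∀ᶠ j in atTop, ¬ HasDeficient (ρ j) m K j (κ j '' L) (W j) := by
  have hfin : (L ∩ B).Finite := by
    by_cases hE : Nonempty E
    · obtain ⟨x₀⟩ := hE
      obtain ⟨R, hR⟩ := hB.subset_closedBall x₀
      exact (hL.finite_ball x₀ R).subset (inter_subset_inter_right _ hR)
    · have := not_nonempty_iff.1 hE
      exact Set.toFinite _
  have e1 : ∀ᶠ j in atTop, ∀ x ∈ L ∩ B,
      (m : ℕ∞) ≤ {y | truncAdj (ρ j) m (κ j '' L) j (κ j x) y ∧ ρ j (κ j x) y ≤ K}.encard := by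
    refine (eventually_all_finite hfin).2 fun x hx => ?_
    set S := {y | A x y ∧ dist x y < K} with hS
    have hSfin : S.Finite := Set.finite_of_encard_le_coe
      ((encard_le_encard fun y hy => hy.1).trans (hA.encard_le hL x))
    have e2 : ∀ᶠ j in atTop, ∀ z ∈ S, (truncAdj (ρ j) m (κ j '' L) j (κ j x) (κ j z) ∧
        ρ j (κ j x) (κ j z) ≤ K) := by
      refine (eventually_all_finite hSfin).2 fun z hz => ?_
      filter_upwards [tendsto_diag_atTop.eventually (h.eventually_truncAdj_iff hL hA hx.1
        ((hA x z).1 hz.1).2.1), (h.tendsto_dist x z).eventually_lt_const hz.2] with j h1 h2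
      exact ⟨h1.2 hz.1, h2.le⟩
    filter_upwards [e2, h.eventually_injOn hSfin] with j h1 h2
    refine (hfull x hx).trans ?_
    rw [← h2.encard_image]
    refine encard_le_encard ?_
    rintro _ ⟨z, hz, rfl⟩
    exact h1 z hz
  filter_upwards [e1] with j hj
  rintro ⟨w, ⟨⟨x, hx, rfl⟩, hw⟩, hlt⟩
  exact not_lt.2 (hj x ⟨hx, (hW j x).1 hw⟩) hlt

/-- At most `m + 1` of a family of disjoint sets with union of diameter less than `K` contain a
point with fewer than `m` partners at distance less than `K`: representatives of these sets are
pairwise matched by the greedy rule. -/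
theorem IsGreedy.card_deficient_le {L : Set E} (hL : IsGeneric L) {m : ℕ} {A : E → E → Prop}
    (hA : IsGreedy L m A) {ι : Type*} (I : Finset ι) (B : ι → Set E)
    (hB : ∀ i ∈ I, ∀ j ∈ I, i ≠ j → Disjoint (B i) (B j)) {K : ℝ}
    (hK : ∀ i ∈ I, ∀ j ∈ I, ∀ x ∈ B i, ∀ y ∈ B j, dist x y < K)
    (hdef : ∀ i ∈ I, ∃ x ∈ L ∩ B i, {y | A x y ∧ dist x y < K}.encard < m) :
    I.card ≤ m + 1 := by
  rcases I.eq_empty_or_nonempty with rfl | ⟨i₀, hi₀⟩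
  · simp
  have : ∀ i : ι, ∃ x : E, i ∈ I → x ∈ L ∩ B i ∧ {y | A x y ∧ dist x y < K}.encard < m := by
    intro i
    by_cases hi : i ∈ I
    · obtain ⟨x, h1, h2⟩ := hdef i hi
      exact ⟨x, fun _ => ⟨h1, h2⟩⟩
    · obtain ⟨x, h1, h2⟩ := hdef i₀ hi₀
      exact ⟨x, fun h => (hi h).elim⟩
  choose x hx using this
  have hinj : Set.InjOn x I := by
    intro i hi j hj hij
    by_contra hne
    exact Set.disjoint_left.1 (hB i hi j hj hne) (hx i hi).1.2 (hij ▸ (hx j hj).1.2)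
  have hfar : ∀ i ∈ I, ∀ j ∈ I, (closer A (x i) (x j)).encard < m := by
    intro i hi j hj
    refine lt_of_le_of_lt (encard_le_encard (show closer A (x i) (x j) ⊆
      {y | A (x i) y ∧ dist (x i) y < K} from fun y hy => ⟨hy.1, hy.2.trans ?_⟩)) (hx i hi).2
    exact hK i hi j hj _ (hx i hi).1.2 _ (hx j hj).1.2
  classical
  have hsub : x '' (I.erase i₀ : Finset ι) ⊆ {y | A (x i₀) y} := by
    rintro _ ⟨i, hi, rfl⟩
    have hi' := Finset.mem_erase.1 (Finset.mem_coe.1 hi)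
    exact (hA _ _).2 ⟨(hx i₀ hi₀).1.1, (hx i hi'.2).1.1,
      fun hc => hi'.1 (hinj hi'.2 hi₀ hc.symm), hfar i₀ hi₀ i hi'.2, hfar i hi'.2 i₀ hi₀⟩
  have h1 := (encard_le_encard hsub).trans (hA.encard_le hL _)
  rw [(hinj.mono (by simp)).encard_image, encard_coe_eq_coe_finsetCard] at h1
  have h2 : (I.erase i₀).card ≤ m := by exact_mod_cast h1
  rw [Finset.card_erase_of_mem hi₀] at h2
  omega

open Classical in
/-- The bound of `IsGreedy.card_deficient_le` holds eventually for the approximations. -/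
theorem IsApprox.eventually_card_hasDeficient_le (h : IsApprox κ ρ δ) {L : Set E}
    (hL : IsGeneric L) {m : ℕ} {A : E → E → Prop} (hA : IsGreedy L m A) {ι : Type*} (I : Finset ι)
    (B : ι → Set E) (W : ι → ℕ → Set X) (hW : ∀ i j x, κ j x ∈ W i j ↔ x ∈ B i)
    (hBb : ∀ i, Bornology.IsBounded (B i))
    (hB : ∀ i ∈ I, ∀ j ∈ I, i ≠ j → Disjoint (B i) (B j)) {K : ℝ}
    (hK : ∀ i ∈ I, ∀ j ∈ I, ∀ x ∈ B i, ∀ y ∈ B j, dist x y < K) :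
    ∀ᶠ j in atTop,
      (I.filter fun i => HasDeficient (ρ j) m K j (κ j '' L) (W i j)).card ≤ m + 1 := by
  set I' := I.filter fun i => ∃ x ∈ L ∩ B i, {y | A x y ∧ dist x y < K}.encard < m with hI'
  have hI'I : I' ⊆ I := Finset.filter_subset _ _
  have hc : I'.card ≤ m + 1 := hA.card_deficient_le hL I' B
    (fun i hi j hj => hB i (hI'I hi) j (hI'I hj)) (fun i hi j hj => hK i (hI'I hi) j (hI'I hj))
    fun i hi => (Finset.mem_filter.1 hi).2
  have e : ∀ᶠ j in atTop, ∀ i ∈ I, i ∉ I' → ¬ HasDeficient (ρ j) m K j (κ j '' L) (W i j) := by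
    refine (I.eventually_all).2 fun i hi => ?_
    by_cases hi' : i ∈ I'
    · exact Eventually.of_forall fun _ h => (h hi').elim
    · have hfull : ∀ x ∈ L ∩ B i, (m : ℕ∞) ≤ {y | A x y ∧ dist x y < K}.encard := by
        intro x hx
        by_contra hcon
        exact hi' (Finset.mem_filter.2 ⟨hi, x, hx, not_le.1 hcon⟩)
      filter_upwards [h.eventually_not_hasDeficient hL hA (hW i) (hBb i) hfull] with j hj _ using hj
  filter_upwards [e] with j hj
  refine (Finset.card_le_card fun i hi => ?_).trans hc
  rw [Finset.mem_filter] at hi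
  by_contra hcon
  exact hj i hi.1 hcon hi.2

end Approximation

/-! ### The grid of mesh `2⁻ʲ` -/

section Grid

variable {d : ℕ}

/-- The index of the cube of the grid of mesh `2⁻ʲ` that contains `x`. -/
noncomputable def cell (j : ℕ) (x : EuclideanSpace ℝ (Fin d)) : Fin d → ℤ :=
  fun i => ⌊(2 ^ j : ℝ) * x i⌋

/-- The lower corner of the cube with index `c`. -/
noncomputable def node (j : ℕ) (c : Fin d → ℤ) : EuclideanSpace ℝ (Fin d) :=
  WithLp.toLp 2 fun i => (c i : ℝ) / 2 ^ j

/-- The distance of two cubes of the grid of mesh `2⁻ʲ`, measured between their lower corners. -/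
noncomputable def gridDist (j : ℕ) (c c' : Fin d → ℤ) : ℝ := dist (node j c) (node j c')

/-- The half-open cube of side `2⁻ʲ` with index `c`. -/
def cube (j : ℕ) (c : Fin d → ℤ) : Set (EuclideanSpace ℝ (Fin d)) := {x | cell j x = c}

/-- An upper bound for the distance of a point to the lower corner of its cube. (It is coarser than
the diameter `√d * 2⁻ʲ`.) -/
noncomputable def mesh (d j : ℕ) : ℝ := d / 2 ^ j

theorem mesh_nonneg (d j : ℕ) : 0 ≤ mesh d j := by unfold mesh; positivity

theorem tendsto_mesh (d : ℕ) : Tendsto (mesh d) atTop (𝓝 0) := by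
  have h := (tendsto_pow_atTop_nhds_zero_of_lt_one (r := (1 / 2 : ℝ)) (by norm_num)
    (by norm_num)).const_mul (d : ℝ)
  rw [mul_zero] at h
  refine h.congr fun j => ?_
  rw [mesh, one_div, inv_pow, div_eq_mul_inv]

theorem dist_node_cell_le (j : ℕ) (x : EuclideanSpace ℝ (Fin d)) :
    dist (node j (cell j x)) x ≤ mesh d j := by
  have h2 : (0 : ℝ) < 2 ^ j := by positivity
  rw [EuclideanSpace.dist_eq]
  refine Real.sqrt_le_iff.2 ⟨mesh_nonneg d j, ?_⟩
  have h : ∀ i, dist ((node j (cell j x)) i) (x i) ^ 2 ≤ (1 / 2 ^ j) ^ 2 := by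
    intro i
    have h1 := Int.floor_le ((2 ^ j : ℝ) * x i)
    have h3 := Int.lt_floor_add_one ((2 ^ j : ℝ) * x i)
    have e : (node j (cell j x)) i = (⌊(2 ^ j : ℝ) * x i⌋ : ℝ) / 2 ^ j := rfl
    have hd : dist ((node j (cell j x)) i) (x i) ≤ 1 / 2 ^ j := by
      rw [e, Real.dist_eq, abs_le]
      constructor
      · rw [neg_le_sub_iff_le_add, ← add_div, le_div_iff₀ h2]
        linarith
      · rw [sub_le_iff_le_add, div_le_iff₀ h2, add_mul, one_div, inv_mul_cancel₀ h2.ne']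
        linarith
    exact pow_le_pow_left₀ dist_nonneg hd 2
  calc ∑ i, dist ((node j (cell j x)) i) (x i) ^ 2 ≤ ∑ _i : Fin d, (1 / 2 ^ j : ℝ) ^ 2 :=
        Finset.sum_le_sum fun i _ => h i
    _ = (d : ℝ) * (1 / 2 ^ j) ^ 2 := by simp
    _ ≤ (d : ℝ) ^ 2 * (1 / 2 ^ j) ^ 2 := by
        gcongr
        exact_mod_cast Nat.le_self_pow two_ne_zero d
    _ = mesh d j ^ 2 := by rw [mesh]; ring

theorem isApprox_cell : IsApprox (E := EuclideanSpace ℝ (Fin d)) cell gridDist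
    (fun j => 2 * mesh d j) where
  tendsto := by simpa using (tendsto_mesh d).const_mul 2
  abs_sub_le := by
    intro j x y
    have h1 := dist_node_cell_le j x
    have h2 := dist_node_cell_le j y
    have h3 := dist_triangle4 (node j (cell j x)) x y (node j (cell j y))
    have h4 := dist_triangle4 x (node j (cell j x)) (node j (cell j y)) y
    rw [dist_comm y] at h3
    rw [dist_comm x (node j (cell j x))] at h4
    rw [gridDist, abs_le]
    constructor <;> linarith

theorem gridDist_add (j : ℕ) (c c' s : Fin d → ℤ) :
    gridDist j (c + s) (c' + s) = gridDist j c c' := by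
  have h : ∀ c : Fin d → ℤ, node j (c + s) = node j c + node j s := by
    intro c
    ext i
    simp [node, add_div]
  rw [gridDist, gridDist, h, h, dist_add_right]

theorem cube_eq_preimage (j : ℕ) (c : Fin d → ℤ) : cube j c =
    WithLp.ofLp ⁻¹' (Set.univ.pi fun i => Ico ((c i : ℝ) / 2 ^ j) ((c i + 1 : ℝ) / 2 ^ j)) := by
  have h2 : (0 : ℝ) < 2 ^ j := by positivity
  ext x
  simp only [cube, cell, mem_ofPred_eq, mem_preimage, mem_univ_pi, mem_Ico, funext_iff,
    Int.floor_eq_iff, div_le_iff₀ h2, lt_div_iff₀ h2, mul_comm]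

theorem measurableSet_cube (j : ℕ) (c : Fin d → ℤ) : MeasurableSet (cube j c) := by
  rw [cube_eq_preimage]
  exact (WithLp.measurable_ofLp 2 _) (MeasurableSet.univ_pi fun i => measurableSet_Ico)

theorem volume_cube (j : ℕ) (c : Fin d → ℤ) :
    volume (cube j c) = ENNReal.ofReal ((1 / 2 ^ j) ^ d) := by
  rw [cube_eq_preimage, (PiLp.volume_preserving_ofLp (Fin d)).measure_preimage
    (MeasurableSet.univ_pi fun i => measurableSet_Ico).nullMeasurableSet, Real.volume_pi_Ico]
  have : ∀ i, ENNReal.ofReal ((c i + 1 : ℝ) / 2 ^ j - (c i : ℝ) / 2 ^ j) =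
      ENNReal.ofReal (1 / 2 ^ j) := by
    intro i
    congr 1
    ring
  simp only [this, Finset.prod_const, Finset.card_univ, Fintype.card_fin]
  rw [ENNReal.ofReal_pow (by positivity)]

theorem disjoint_cube (j : ℕ) {c c' : Fin d → ℤ} (h : c ≠ c') :
    Disjoint (cube j c) (cube j c') := by
  rw [Set.disjoint_left]
  intro x hx hx'
  exact h (Eq.trans (Eq.symm hx) hx')

theorem card_mul_volume_cube_le (j : ℕ) (F : Finset (Fin d → ℤ))
    {T : Set (EuclideanSpace ℝ (Fin d))} (h : ∀ c ∈ F, cube j c ⊆ T) :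
    (F.card : ℝ≥0∞) * ENNReal.ofReal ((1 / 2 ^ j) ^ d) ≤ volume T := by
  calc (F.card : ℝ≥0∞) * ENNReal.ofReal ((1 / 2 ^ j) ^ d) = ∑ c ∈ F, volume (cube j c) := by
        simp [volume_cube]
    _ = volume (⋃ c ∈ F, cube j c) :=
        (measure_biUnion_finset (fun c _ c' _ hne => disjoint_cube j hne)
          fun c _ => measurableSet_cube j c).symm
    _ ≤ volume T := measure_mono (iUnion₂_subset h)

/-- Annuli of bounded outer radius have volume at most proportional to their width. -/
theorem exists_volume_annulus_le (hd : 1 ≤ d) (R : ℝ) :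
    ∃ C : ℝ≥0, ∀ (x : EuclideanSpace ℝ (Fin d)) (r h : ℝ), 0 ≤ r → 0 ≤ h → r + h ≤ R →
      volume {y | |dist x y - r| ≤ h} ≤ C * ENNReal.ofReal h := by
  have : NeZero d := ⟨by omega⟩
  have hV : volume (Metric.ball (0 : EuclideanSpace ℝ (Fin d)) 1) ≠ ∞ := measure_ball_lt_top.ne
  refine ⟨(2 * d * R ^ (d - 1)).toNNReal *
    (volume (Metric.ball (0 : EuclideanSpace ℝ (Fin d)) 1)).toNNReal, fun x r h hr hh hR => ?_⟩
  have hb : 0 ≤ max (r - h) 0 := le_max_right _ _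
  have hbr : max (r - h) 0 ≤ r + h := max_le (by linarith) (by linarith)
  have hsub : {y | |dist x y - r| ≤ h} ⊆
      Metric.closedBall x (r + h) \ Metric.ball x (max (r - h) 0) := by
    intro y hy
    have hy' := abs_le.1 (show |dist x y - r| ≤ h from hy)
    refine ⟨?_, ?_⟩
    · rw [Metric.mem_closedBall, dist_comm]
      linarith [hy'.2]
    · rw [Metric.mem_ball, not_lt, dist_comm]
      exact max_le (by linarith [hy'.1]) dist_nonneg
  refine (measure_mono hsub).trans ?_
  rw [measure_sdiff (Metric.ball_subset_ball hbr |>.trans Metric.ball_subset_closedBall)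
    measurableSet_ball.nullMeasurableSet measure_ball_lt_top.ne,
    Measure.addHaar_closedBall _ _ (by linarith), Measure.addHaar_ball _ _ hb,
    ← ENNReal.sub_mul (fun _ _ => hV), finrank_euclideanSpace, Fintype.card_fin,
    ← ENNReal.ofReal_sub _ (by positivity)]
  have hpow : (r + h) ^ d - (max (r - h) 0) ^ d ≤ 2 * d * R ^ (d - 1) * h := by
    have h1 := (le_abs_self _).trans (abs_pow_sub_pow_le (r + h) (max (r - h) 0) d)
    refine h1.trans ?_
    rw [abs_of_nonneg (by linarith : 0 ≤ r + h), abs_of_nonneg hb, max_eq_left hbr,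
      abs_of_nonneg (by linarith)]
    have h2 : r + h - max (r - h) 0 ≤ 2 * h := by linarith [le_max_left (r - h) 0]
    calc (r + h - max (r - h) 0) * d * (r + h) ^ (d - 1) ≤ (2 * h) * d * R ^ (d - 1) := by
          gcongr
      _ = _ := by ring
  calc _ ≤ ENNReal.ofReal (2 * d * R ^ (d - 1) * h) *
        volume (Metric.ball (0 : EuclideanSpace ℝ (Fin d)) 1) := by
        gcongr
    _ = _ := by
        have hR0 : 0 ≤ R := by linarith
        rw [ENNReal.ofReal_mul (by positivity), ENNReal.coe_mul, ENNReal.coe_toNNReal hV]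
        simp only [ENNReal.ofReal]
        ring

/-- The indices of the cubes whose distance from the cube `c₀` is within `h` of `r`. -/
def gridAnnulus (j : ℕ) (c₀ : Fin d → ℤ) (r h : ℝ) : Set (Fin d → ℤ) :=
  {c | |gridDist j c₀ c - r| ≤ h}

theorem mem_gridAnnulus {j : ℕ} {c₀ c : Fin d → ℤ} {r h : ℝ} :
    c ∈ gridAnnulus j c₀ r h ↔ |gridDist j c₀ c - r| ≤ h := Iff.rfl

theorem cube_subset_annulus {j : ℕ} {c₀ c : Fin d → ℤ} {r h : ℝ} (hc : c ∈ gridAnnulus j c₀ r h) :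
    cube j c ⊆ {y | |dist (node j c₀) y - r| ≤ h + mesh d j} := by
  intro y hy
  have hy' : cell j y = c := hy
  have h1 := dist_node_cell_le j y
  rw [hy'] at h1
  have h2 := dist_triangle (node j c₀) (node j c) y
  have h3 := dist_triangle (node j c₀) y (node j c)
  rw [dist_comm y] at h3
  have h4 := abs_le.1 (show |dist (node j c₀) (node j c) - r| ≤ h from hc)
  change |dist (node j c₀) y - r| ≤ h + mesh d j
  rw [abs_le]
  constructor <;> linarith [h4.1, h4.2]

theorem finite_gridAnnulus (j : ℕ) (c₀ : Fin d → ℤ) (r h : ℝ) :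
    (gridAnnulus j c₀ r h).Finite := by
  have h2 : (0 : ℝ) < 2 ^ j := by positivity
  refine (Set.finite_Icc (c₀ - fun _ => ⌈(r + h) * 2 ^ j⌉)
    (c₀ + fun _ => ⌈(r + h) * 2 ^ j⌉)).subset ?_
  intro c hc
  have h4 := (abs_le.1 (show |dist (node j c₀) (node j c) - r| ≤ h from hc)).2
  have key : ∀ i, |(c₀ i : ℝ) - c i| ≤ ⌈(r + h) * 2 ^ j⌉ := by
    intro i
    have h5 := PiLp.norm_apply_le (node j c₀ - node j c) i
    rw [← dist_eq_norm] at h5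
    have h6 : (node j c₀ - node j c) i = ((c₀ i : ℝ) - c i) / 2 ^ j := by
      simp [node, sub_div]
    rw [h6, Real.norm_eq_abs, abs_div, abs_of_pos h2] at h5
    have h7 : |(c₀ i : ℝ) - c i| / 2 ^ j ≤ r + h := by linarith
    rw [div_le_iff₀ h2] at h7
    exact h7.trans (Int.le_ceil _)
  constructor
  · intro i
    have := (abs_le.1 (key i)).2
    have : c₀ i - c i ≤ ⌈(r + h) * 2 ^ j⌉ := by exact_mod_cast this
    simp only [Pi.sub_apply]
    linarith
  · intro i
    have := (abs_le.1 (key i)).1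
    have : -⌈(r + h) * 2 ^ j⌉ ≤ c₀ i - c i := by exact_mod_cast this
    simp only [Pi.add_apply]
    linarith

/-- The number of cubes in a grid annulus, times the volume of a cube, is at most proportional to
the width of the annulus plus the mesh. -/
theorem exists_card_gridAnnulus_le (hd : 1 ≤ d) (R : ℝ) :
    ∃ C : ℝ≥0, ∀ (j : ℕ) (c₀ : Fin d → ℤ) (r h : ℝ), 0 ≤ r → 0 ≤ h → r + h + mesh d j ≤ R →
      ((finite_gridAnnulus j c₀ r h).toFinset.card : ℝ≥0∞) * ENNReal.ofReal ((1 / 2 ^ j) ^ d) ≤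
        C * ENNReal.ofReal (h + mesh d j) := by
  obtain ⟨C, hC⟩ := exists_volume_annulus_le hd R
  refine ⟨C, fun j c₀ r h hr hh hR => ?_⟩
  refine (card_mul_volume_cube_le j _ fun c hc => cube_subset_annulus
    ((finite_gridAnnulus j c₀ r h).mem_toFinset.1 hc)).trans ?_
  exact hC _ _ _ hr (add_nonneg hh (mesh_nonneg d j)) (by linarith)

theorem cell_zero_eq (j : ℕ) (x : EuclideanSpace ℝ (Fin d)) (i : Fin d) :
    cell j x i / 2 ^ j = cell 0 x i := by
  have h := Int.natCast_mul_floor_div_cancel (n := 2 ^ j) (by positivity) (x i)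
  simpa [cell] using h

end Grid

/-! ### The field of occupied cells -/

section Occupancy

/-- If `A` is almost surely contained in the limit inferior of the events `E j`, its measure is at
most any eventual bound for `P (E j)`. None of the sets has to be measurable. -/
theorem measure_le_of_eventually {Ω : Type*} [MeasurableSpace Ω] {P : Measure Ω} {A : Set Ω}
    {E : ℕ → Set Ω} {b : ℝ≥0∞} (hA : ∀ᵐ ω ∂P, ω ∈ A → ∀ᶠ j in atTop, ω ∈ E j)
    (hE : ∀ᶠ j in atTop, P (E j) ≤ b) : P A ≤ b := by
  have h1 : A ≤ᵐ[P] ⋃ J, ⋂ j ∈ Ici J, E j := by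
    filter_upwards [hA] with ω h hω
    obtain ⟨J, hJ⟩ := eventually_atTop.1 (h hω)
    exact mem_iUnion.2 ⟨J, mem_iInter₂.2 fun j hj => hJ j hj⟩
  refine (measure_mono_ae h1).trans ?_
  rw [Monotone.measure_iUnion]
  · refine iSup_le fun J => ?_
    obtain ⟨j, h, hj⟩ := (hE.and (eventually_ge_atTop J)).exists
    exact (measure_mono (iInter₂_subset j hj)).trans h
  · exact fun J J' h => iInter₂_mono' fun j hj => ⟨j, le_trans h hj, le_rfl⟩

variable {d : ℕ} {Ω : Type*} [MeasurableSpace Ω] {P : Measure Ω} {r : ℝ≥0}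
  {L : Ω → Set (EuclideanSpace ℝ (Fin d))}

/-- The set of (indices of) cubes of the grid of mesh `2⁻ʲ` that contain a point of `L ω`. -/
def occ (L : Ω → Set (EuclideanSpace ℝ (Fin d))) (j : ℕ) (ω : Ω) : Set (Fin d → ℤ) :=
  cell j '' L ω

omit [MeasurableSpace Ω] in
theorem mem_occ_iff {j : ℕ} {c : Fin d → ℤ} {ω : Ω} :
    c ∈ occ L j ω ↔ (L ω ∩ cube j c).encard ≠ 0 := by
  rw [Ne, Set.encard_eq_zero, ← Ne, ← Set.nonempty_iff_ne_empty]
  rfl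

theorem volume_cube_ne_top (j : ℕ) (c : Fin d → ℤ) : volume (cube j c) ≠ ∞ := by
  rw [volume_cube]
  exact ENNReal.ofReal_ne_top

theorem IsPoissonProcess.iIndepFun_occ (hL : IsPoissonProcess P r L) (j : ℕ) :
    iIndepFun (fun (c : Fin d → ℤ) ω => c ∈ occ L j ω) P := by
  have h1 : iIndepFun (fun (c : Fin d → ℤ) ω => (L ω ∩ cube j c).encard) P := by
    rw [iIndepFun_iff_finset]
    intro s
    let e := s.equivFin
    have h2 := hL.indep_count s.card (fun i => cube j (e.symm i))
      (fun i => measurableSet_cube _ _) (fun i => volume_cube_ne_top _ _)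
      (fun i i' hne => disjoint_cube j fun h => hne (e.symm.injective (Subtype.ext h)))
    have h3 := h2.precomp e.injective
    simpa [Finset.restrict_def] using h3
  have h2 := h1.comp (fun _ n => n ≠ 0) fun _ => by measurability
  simpa only [Function.comp_def, mem_occ_iff] using h2

theorem IsPoissonProcess.aemeasurable_occ (hL : IsPoissonProcess P r L) (j : ℕ)
    (c : Fin d → ℤ) : AEMeasurable (fun ω => c ∈ occ L j ω) P := by
  have h := (hL.hasLaw_count _ (measurableSet_cube j c) (volume_cube_ne_top _ _)).aemeasurable
  have h2 : Measurable (fun n : ℕ∞ => n ≠ 0) := by measurability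
  simpa only [Function.comp_def, mem_occ_iff] using h2.comp_aemeasurable h

theorem IsPoissonProcess.map_occ (hL : IsPoissonProcess P r L) (j : ℕ)
    (c c' : Fin d → ℤ) : P.map (fun ω => c ∈ occ L j ω) = P.map (fun ω => c' ∈ occ L j ω) := by
  have h2 : Measurable (fun n : ℕ∞ => n ≠ 0) := by measurability
  have key : ∀ c : Fin d → ℤ, P.map (fun ω => c ∈ occ L j ω) =
      ((poissonMeasure (r * (ENNReal.ofReal ((1 / 2 ^ j) ^ d)).toNNReal)).map
        (fun n : ℕ => (n : ℕ∞))).map (fun n : ℕ∞ => n ≠ 0) := by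
    intro c
    have h := hL.hasLaw_count _ (measurableSet_cube j c) (volume_cube_ne_top _ _)
    rw [volume_cube] at h
    rw [← h.map_eq, AEMeasurable.map_map_of_aemeasurable h2.aemeasurable h.aemeasurable]
    simp only [Function.comp_def, mem_occ_iff]
  rw [key, key]

theorem IsPoissonProcess.measure_occ_le (hL : IsPoissonProcess P r L) (j : ℕ) (c : Fin d → ℤ) :
    P {ω | c ∈ occ L j ω} ≤ r * ENNReal.ofReal ((1 / 2 ^ j) ^ d) := by
  have h := hL.hasLaw_count _ (measurableSet_cube j c) (volume_cube_ne_top _ _)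
  rw [volume_cube] at h
  set μ : ℝ≥0 := r * (ENNReal.ofReal ((1 / 2 ^ j) ^ d)).toNNReal with hμ
  have hm : MeasurableSet {n : ℕ∞ | n ≠ 0} := by measurability
  have h1 := h.measure_eq hm
  simp only [mem_occ_iff]
  rw [h1, Measure.map_apply (by fun_prop) hm]
  have h2 : (fun n : ℕ => (n : ℕ∞)) ⁻¹' {n : ℕ∞ | n ≠ 0} = {0}ᶜ := by
    ext n
    simp
  rw [h2, prob_compl_eq_one_sub (measurableSet_singleton 0), poissonMeasure_singleton]
  have h3 : (μ : ℝ≥0∞) = r * ENNReal.ofReal ((1 / 2 ^ j) ^ d) := by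
    rw [hμ, ENNReal.coe_mul, ENNReal.coe_toNNReal ENNReal.ofReal_ne_top]
  rw [← h3, tsub_le_iff_right, ← ENNReal.ofReal_coe_nnreal, ← ENNReal.ofReal_add (by positivity)
    (by positivity), ← ENNReal.ofReal_one]
  refine ENNReal.ofReal_le_ofReal ?_
  have := Real.add_one_le_exp (-(μ : ℝ))
  simp
  linarith

theorem IsPoissonProcess.measure_forall_occ_le (hL : IsPoissonProcess P r L) (j : ℕ)
    (l : List (Fin d → ℤ)) (hl : l.Nodup) :
    P {ω | ∀ c ∈ l, c ∈ occ L j ω} ≤ (r * ENNReal.ofReal ((1 / 2 ^ j) ^ d)) ^ l.length := by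
  classical
  have h := (hL.iIndepFun_occ j).measure_inter_preimage_eq_mul l.toFinset
    (sets := fun _ => {p : Prop | p}) (fun _ _ => by measurability)
  have e : {ω | ∀ c ∈ l, c ∈ occ L j ω} =
      ⋂ i ∈ l.toFinset, (fun ω => i ∈ occ L j ω) ⁻¹' {p : Prop | p} := by
    ext ω
    simp
  rw [e, h]
  refine (Finset.prod_le_prod' (g := fun _ => r * ENNReal.ofReal ((1 / 2 ^ j) ^ d))
    fun c _ => hL.measure_occ_le j c).trans ?_
  rw [Finset.prod_const, List.toFinset_card_of_nodup hl]

theorem IsPoissonProcess.measure_exists_list_le (hL : IsPoissonProcess P r L) (j n : ℕ)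
    (F : Finset (List (Fin d → ℤ))) (hF : ∀ l ∈ F, l.length = n) :
    P {ω | ∃ l ∈ F, l.Nodup ∧ ∀ c ∈ l, c ∈ occ L j ω} ≤
      F.card * (r * ENNReal.ofReal ((1 / 2 ^ j) ^ d)) ^ n := by
  have e : {ω | ∃ l ∈ F, l.Nodup ∧ ∀ c ∈ l, c ∈ occ L j ω} =
      ⋃ l ∈ F, {ω | l.Nodup ∧ ∀ c ∈ l, c ∈ occ L j ω} := by
    ext ω
    simp only [mem_iUnion, mem_ofPred_eq, exists_prop]
  rw [e]
  refine (measure_biUnion_finset_le _ _).trans ?_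
  rw [← nsmul_eq_mul]
  refine Finset.sum_le_card_nsmul _ _ _ fun l hl => ?_
  by_cases hnd : l.Nodup
  · simpa [hnd, hF l hl] using hL.measure_forall_occ_le j l hnd
  · simp [hnd]

theorem IsPoissonProcess.ae_finite (hL : IsPoissonProcess P r L) :
    ∀ᵐ ω ∂P, ∀ (x : EuclideanSpace ℝ (Fin d)) (R : ℝ), (L ω ∩ Metric.closedBall x R).Finite := by
  have h : ∀ n : ℕ, ∀ᵐ ω ∂P, (L ω ∩ Metric.closedBall 0 (n : ℝ)).Finite := by
    intro n
    have h := hL.hasLaw_count (Metric.closedBall 0 (n : ℝ)) measurableSet_closedBall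
      measure_closedBall_lt_top.ne
    have hm : MeasurableSet {k : ℕ∞ | k = ⊤} := by measurability
    have h1 := h.measure_eq hm
    rw [Measure.map_apply (by fun_prop) hm] at h1
    have h2 : (fun n : ℕ => (n : ℕ∞)) ⁻¹' {k : ℕ∞ | k = ⊤} = ∅ := by
      ext n
      simp
    rw [h2, measure_empty] at h1
    rw [ae_iff]
    simpa only [Set.encard_eq_top_iff, Set.Infinite] using h1
  filter_upwards [ae_all_iff.2 h] with ω hω x R
  obtain ⟨n, hn⟩ := exists_nat_ge (R + dist x 0)
  exact (hω n).subset (inter_subset_inter_right _ (Metric.closedBall_subset_closedBall' hn))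

end Occupancy

/-! ### Paths and descending sequences -/

section Paths

/-- The paths of `n` steps from a vertex, as lists of `n + 1` vertices, where `N c` is the set of
possible successors of `c`. -/
def pathsFrom {α : Type*} [DecidableEq α] (N : α → Finset α) : ℕ → α → Finset (List α)
  | 0, c => {[c]}
  | n + 1, c => (N c).biUnion fun c' => (pathsFrom N n c').image (List.cons c)

theorem length_of_mem_pathsFrom {α : Type*} [DecidableEq α] {N : α → Finset α} :
    ∀ {n : ℕ} {c : α} {l : List α}, l ∈ pathsFrom N n c → l.length = n + 1
  | 0, c, l, h => by
    rw [pathsFrom, Finset.mem_singleton] at h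
    simp [h]
  | n + 1, c, l, h => by
    rw [pathsFrom, Finset.mem_biUnion] at h
    obtain ⟨c', _, h⟩ := h
    obtain ⟨l', hl', rfl⟩ := Finset.mem_image.1 h
    simp [length_of_mem_pathsFrom hl']

theorem mem_pathsFrom {α : Type*} [DecidableEq α] {N : α → Finset α} :
    ∀ {c : α} {l : List α}, (c :: l).IsChain (fun a b => b ∈ N a) →
      c :: l ∈ pathsFrom N l.length c
  | c, [], _ => by simp [pathsFrom]
  | c, c' :: l, h => by
    rw [List.isChain_cons_cons] at h
    rw [List.length_cons, pathsFrom, Finset.mem_biUnion]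
    exact ⟨c', h.1, Finset.mem_image_of_mem _ (mem_pathsFrom h.2)⟩

theorem card_pathsFrom_le {α : Type*} [DecidableEq α] {N : α → Finset α} {b : ℕ}
    (hN : ∀ c, (N c).card ≤ b) : ∀ (n : ℕ) (c : α), (pathsFrom N n c).card ≤ b ^ n
  | 0, c => by simp [pathsFrom]
  | n + 1, c => by
    rw [pathsFrom]
    refine (Finset.card_biUnion_le_card_mul _ _ (b ^ n) fun c' _ =>
      Finset.card_image_le.trans (card_pathsFrom_le hN n c')).trans ?_
    rw [pow_succ']
    exact Nat.mul_le_mul_right _ (hN c)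

/-- If, for each bound `R`, there is a tolerance `h > 0` such that for every rational `q ≤ R` the
self-avoiding paths in `L` from any given point with all step lengths in `[q - h, q + h]` have
bounded length, then there are no infinite descending sequences. -/
theorem wellFounded_desc {E : Type*} [MetricSpace E] {L : Set E}
    (hfin : ∀ (x : E) (R : ℝ), (L ∩ Metric.closedBall x R).Finite)
    (hpath : ∀ R : ℕ, ∃ h : ℝ, 0 < h ∧ ∀ q : ℚ, (0 : ℝ) ≤ q → (q : ℝ) ≤ R → ∀ x ∈ L, ∃ n : ℕ,
      ∀ l : List E, (x :: l).Nodup → (x :: l).IsChain (fun a b => |dist a b - q| ≤ h) →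
        (∀ y ∈ x :: l, y ∈ L) → l.length ≠ n) :
    WellFounded (Desc L) := by
  rw [wellFounded_iff_isEmpty_descending_chain]
  refine ⟨fun ⟨f, hf⟩ => ?_⟩
  set D : ℕ → ℝ := fun n => dist (f n).1 (f n).2 with hD
  have hanti : StrictAnti D := strictAnti_nat_of_succ_lt fun n => (hf n).2.2.1
  have hbdd : BddBelow (range D) := ⟨0, by rintro _ ⟨n, rfl⟩; exact dist_nonneg⟩
  have hlim := tendsto_atTop_ciInf hanti.antitone hbdd
  set ℓ := ⨅ n, D n with hℓ
  have hℓ0 : 0 ≤ ℓ := le_ciInf fun n => dist_nonneg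
  have hlt : ∀ n, ℓ < D n := fun n => (ciInf_le hbdd (n + 1)).trans_lt (hanti n.lt_succ_self)
  obtain ⟨R, hR⟩ := exists_nat_ge (ℓ + 1)
  obtain ⟨h, hh, hp⟩ := hpath R
  obtain ⟨q, hq1, hq2⟩ := exists_rat_btwn (show ℓ < ℓ + min h 1 by simp [hh])
  have hq3 : (q : ℝ) < ℓ + h := hq2.trans_le (by gcongr; exact min_le_left _ _)
  have hq4 : (q : ℝ) < ℓ + 1 := hq2.trans_le (by gcongr; exact min_le_right _ _)
  -- From `n₀` on, all lengths lie in `(ℓ, q)`, and `q < ℓ + h`.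
  obtain ⟨n₀, hn₀⟩ := eventually_atTop.1 (hlim.eventually_lt_const hq1)
  let G : SimpleGraph E :=
    { Adj := fun a b => a ≠ b ∧ a ∈ L ∧ b ∈ L ∧ |dist a b - q| ≤ h
      symm := ⟨fun a b hab => ⟨hab.1.symm, hab.2.2.1, hab.2.1, by rw [dist_comm]; exact hab.2.2.2⟩⟩
      loopless := ⟨fun a ha => ha.1 rfl⟩ }
  have hadj : ∀ n, n₀ ≤ n → G.Adj (f (n + 1)).1 (f (n + 1)).2 := by
    intro n hn
    refine ⟨fun heq => ?_, (hf n).1, (hf n).2.1, ?_⟩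
    · have := hlt (n + 1)
      simp only [hD, heq, dist_self] at this
      linarith
    · have h1 := hlt (n + 1)
      have h2 := hn₀ (n + 1) (by omega)
      rw [abs_le]
      constructor
      · change -h ≤ D (n + 1) - q
        linarith
      · change D (n + 1) - q ≤ h
        linarith
  set x := (f (n₀ + 1)).1 with hx
  have hxL : x ∈ L := (hf n₀).1
  have hreach : ∀ k, G.Reachable x (f (n₀ + k + 1)).1 ∧ G.Reachable x (f (n₀ + k + 1)).2 := by
    intro k
    induction k with
    | zero => exact ⟨.rfl, (hadj n₀ le_rfl).reachable⟩
    | succ k ih =>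
      have ha := (hadj (n₀ + (k + 1)) (by omega)).reachable
      have hs := (hf (n₀ + k + 1)).2.2.2
      rcases hs with hs | hs | hs | hs
      · have h1 : G.Reachable x (f (n₀ + (k + 1) + 1)).1 := by
          rw [show n₀ + (k + 1) + 1 = n₀ + k + 1 + 1 by ring, hs]; exact ih.1
        exact ⟨h1, h1.trans ha⟩
      · have h1 : G.Reachable x (f (n₀ + (k + 1) + 1)).1 := by
          rw [show n₀ + (k + 1) + 1 = n₀ + k + 1 + 1 by ring, hs]; exact ih.2
        exact ⟨h1, h1.trans ha⟩
      · have h1 : G.Reachable x (f (n₀ + (k + 1) + 1)).2 := by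
          rw [show n₀ + (k + 1) + 1 = n₀ + k + 1 + 1 by ring, hs]; exact ih.1
        exact ⟨h1.trans ha.symm, h1⟩
      · have h1 : G.Reachable x (f (n₀ + (k + 1) + 1)).2 := by
          rw [show n₀ + (k + 1) + 1 = n₀ + k + 1 + 1 by ring, hs]; exact ih.2
        exact ⟨h1.trans ha.symm, h1⟩
  obtain ⟨n, hn⟩ := hp q (hℓ0.trans hq1.le) (by linarith) x hxL
  have hdist : ∀ {u v : E} (w : G.Walk u v), dist u v ≤ w.length * (q + h) := by
    intro u v w
    induction w with
    | nil => simp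
    | @cons a b c hab w ih =>
      have h1 := (abs_le.1 hab.2.2.2).2
      have h2 := dist_triangle a b c
      rw [SimpleGraph.Walk.length_cons]
      push_cast
      linarith
  have hwalkL : ∀ {u v : E} (w : G.Walk u v), u ∈ L → ∀ y ∈ w.support, y ∈ L := by
    intro u v w
    induction w with
    | nil =>
      intro hu y hy
      rw [SimpleGraph.Walk.support_nil, List.mem_singleton] at hy
      exact hy ▸ hu
    | @cons a b c hab w ih =>
      intro hu y hy
      rw [SimpleGraph.Walk.support_cons, List.mem_cons] at hy
      rcases hy with rfl | hy
      · exact hu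
      · exact ih hab.2.2.1 y hy
  -- A path of `n` or more steps could be cut to one of exactly `n` steps.
  have hball : ∀ y, G.Reachable x y → y ∈ Metric.closedBall x (n * (q + h)) := by
    classical
    rintro y ⟨w⟩
    have hpth := w.toPath.2
    set p := w.toPath.1 with hp'
    have hlen : p.length < n := by
      by_contra hcon
      have hsup := p.cons_tail_support.symm
      have e : x :: (p.support.tail.take n) = p.support.take (n + 1) := by
        conv_rhs => rw [hsup]
        rw [List.take_succ_cons]
      refine hn (p.support.tail.take n) ?_ ?_ ?_ ?_
      · rw [e]
        exact hpth.support_nodup.sublist (List.take_sublist _ _)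
      · rw [e]
        exact (p.isChain_adj_support.take _).imp fun a b hab => hab.2.2.2
      · rw [e]
        exact fun y hy => hwalkL p hxL y (List.mem_of_mem_take hy)
      · rw [List.length_take, List.length_tail, p.length_support]
        omega
    rw [Metric.mem_closedBall, dist_comm]
    refine (hdist p).trans ?_
    have : (0 : ℝ) ≤ q + h := by linarith
    gcongr
  have hfin' := hfin x (n * (q + h))
  have hinj : Function.Injective fun k => f (n₀ + k + 1) := by
    intro k k' hkk
    have : D (n₀ + k + 1) = D (n₀ + k' + 1) := by
      simp only [hD]
      rw [show f (n₀ + k + 1) = f (n₀ + k' + 1) from hkk]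
    have := hanti.injective this
    omega
  refine Set.infinite_of_injective_forall_mem hinj (s := (L ∩ Metric.closedBall x (n * (q + h))) ×ˢ
    (L ∩ Metric.closedBall x (n * (q + h)))) (fun k => ?_) (hfin'.prod hfin')
  exact ⟨⟨(hf _).1, hball _ (hreach k).1⟩, ⟨(hf _).2.1, hball _ (hreach k).2⟩⟩

end Paths

/-! ### Poisson processes are almost surely generic -/

section Scalene

variable {d : ℕ}

/-- The integers `f a` with `f a * v ≤ B` attain a maximum, which satisfies the same bound. -/
theorem exists_nat_bound {α : Type*} [Nonempty α] {f : α → ℕ} {v B : ℝ≥0∞} (hv : v ≠ 0)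
    (hB : B ≠ ∞) (h : ∀ a, (f a : ℝ≥0∞) * v ≤ B) :
    ∃ N : ℕ, (∀ a, f a ≤ N) ∧ (N : ℝ≥0∞) * v ≤ B := by
  have hbdd : BddAbove (range f) := by
    have hBv : B / v ≠ ∞ := (ENNReal.div_lt_top hB hv).ne
    obtain ⟨n, hn⟩ := exists_nat_ge (B / v).toReal
    refine ⟨n, ?_⟩
    rintro _ ⟨a, rfl⟩
    have h1 : (f a : ℝ≥0∞) ≤ B / v := by
      rw [ENNReal.le_div_iff_mul_le (Or.inl hv) (Or.inr hB)]
      exact h a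
    have h2 := ENNReal.toReal_mono hBv h1
    rw [ENNReal.toReal_natCast] at h2
    exact_mod_cast h2.trans hn
  obtain ⟨a, ha⟩ := Nat.sSup_mem (range_nonempty f) hbdd
  exact ⟨sSup (range f), fun a => le_csSup hbdd ⟨a, rfl⟩, ha ▸ h a⟩

theorem mesh_le (d j : ℕ) : mesh d j ≤ d := by
  unfold mesh
  exact div_le_self (by positivity) (one_le_pow₀ (by norm_num))

/-- A version of `exists_card_gridAnnulus_le` with a bound on the number of cubes that is uniform in
the centre and the radius. -/
theorem exists_card_gridAnnulus_le_nat (hd : 1 ≤ d) (R : ℝ) :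
    ∃ C : ℝ≥0, ∀ (j : ℕ) (h : ℝ), 0 ≤ h → ∃ N : ℕ,
      (∀ (c₀ : Fin d → ℤ) (r : ℝ), 0 ≤ r → r + h ≤ R →
        (finite_gridAnnulus j c₀ r h).toFinset.card ≤ N) ∧
      (N : ℝ≥0∞) * ENNReal.ofReal ((1 / 2 ^ j) ^ d) ≤ C * ENNReal.ofReal (h + mesh d j) := by
  obtain ⟨C, hC⟩ := exists_card_gridAnnulus_le hd (R + d)
  refine ⟨C, fun j h hh => ?_⟩
  by_cases hhR : h ≤ R
  · have : Nonempty {r : ℝ // 0 ≤ r ∧ r + h ≤ R} := ⟨⟨0, le_rfl, by linarith⟩⟩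
    obtain ⟨N, h1, h2⟩ := exists_nat_bound (α := (Fin d → ℤ) × {r : ℝ // 0 ≤ r ∧ r + h ≤ R})
      (f := fun a => (finite_gridAnnulus j a.1 a.2 h).toFinset.card)
      (v := ENNReal.ofReal ((1 / 2 ^ j) ^ d)) (B := C * ENNReal.ofReal (h + mesh d j))
      (by rw [Ne, ENNReal.ofReal_eq_zero, not_le]; positivity)
      (ENNReal.mul_ne_top ENNReal.coe_ne_top ENNReal.ofReal_ne_top)
      (fun a => hC j a.1 a.2 h a.2.2.1 hh (by linarith [mesh_le d j, a.2.2.2]))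
    exact ⟨N, fun c₀ r hr hrR => h1 ⟨c₀, r, hr, hrR⟩, h2⟩
  · exact ⟨0, fun c₀ r hr hrR => by linarith, by simp⟩

/-- The cubes meeting a ball around the origin lie in a grid ball, written as an annulus of radius
`0`. -/
theorem cell_mem_gridAnnulus (j : ℕ) {x : EuclideanSpace ℝ (Fin d)} {K : ℝ}
    (hx : x ∈ Metric.closedBall 0 K) : cell j x ∈ gridAnnulus j 0 0 (K + d) := by
  have h0 : node j (0 : Fin d → ℤ) = 0 := by
    ext i
    simp [node]
  have h1 := dist_node_cell_le j x
  have h2 := dist_triangle (node j (cell j x)) x 0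
  rw [Metric.mem_closedBall] at hx
  change |dist (node j 0) (node j (cell j x)) - 0| ≤ K + d
  rw [h0, sub_zero, abs_of_nonneg dist_nonneg, dist_comm]
  linarith [mesh_le d j]

variable {Ω : Type*} [MeasurableSpace Ω] {P : Measure Ω} {r : ℝ≥0}
  {L : Ω → Set (EuclideanSpace ℝ (Fin d))}

theorem ae_of_forall_measure_le {p : Ω → Prop} {b : ℕ → ℝ≥0∞} (hb : Tendsto b atTop (𝓝 0))
    (h : ∀ n, P {ω | ¬ p ω} ≤ b n) : ∀ᵐ ω ∂P, p ω := by
  rw [ae_iff]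
  exact le_antisymm (ge_of_tendsto' hb h) (zero_le)

/-- An isosceles triangle in a ball yields, on fine grids, three distinct occupied cubes of which
the third is confined, given the first two, to an annulus of width `O(2⁻ʲ)`. The expected number of
such triples tends to zero. -/
theorem IsPoissonProcess.ae_scalene (hd : 1 ≤ d) (hL : IsPoissonProcess P r L) :
    ∀ᵐ ω ∂P, ∀ x ∈ L ω, ∀ y ∈ L ω, ∀ z ∈ L ω, y ≠ z → dist x y ≠ dist x z := by
  have main : ∀ K : ℕ, ∀ᵐ ω ∂P, ¬ ∃ l : List (EuclideanSpace ℝ (Fin d)), ∃ x y z,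
      l = [x, y, z] ∧ l.Nodup ∧ dist x y = dist x z ∧ ∀ u ∈ l, u ∈ L ω ∩ Metric.closedBall 0 K := by
    intro K
    set S : ℕ → Finset (Fin d → ℤ) := fun j =>
      (finite_gridAnnulus j 0 0 ((K : ℝ) + d)).toFinset with hS
    obtain ⟨C₁, hC₁⟩ := exists_card_gridAnnulus_le_nat hd ((K : ℝ) + d)
    obtain ⟨C₂, hC₂⟩ := exists_card_gridAnnulus_le_nat hd (2 * ((K : ℝ) + d) + 4 * d)
    set v : ℕ → ℝ≥0∞ := fun j => ENNReal.ofReal ((1 / 2 ^ j) ^ d) with hv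
    set D : ℝ≥0∞ := r * (C₁ * ENNReal.ofReal ((K : ℝ) + d + d)) with hD
    have hDtop : D ≠ ∞ := by finiteness
    let F : ℕ → Finset (List (Fin d → ℤ)) := fun j =>
      (S j).biUnion fun c₁ => (S j).biUnion fun c₂ =>
        (finite_gridAnnulus j c₁ (gridDist j c₁ c₂) (4 * mesh d j)).toFinset.image
          fun c₃ => [c₁, c₂, c₃]
    have hF3 : ∀ j, ∀ l ∈ F j, l.length = 3 := by
      intro j l hl
      simp only [F, Finset.mem_biUnion, Finset.mem_image] at hl
      obtain ⟨c₁, _, c₂, _, c₃, _, rfl⟩ := hl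
      rfl
    set b : ℕ → ℝ≥0∞ := fun j => D * (D * (r * (C₂ * ENNReal.ofReal (5 * mesh d j)))) with hb
    have hb0 : Tendsto b atTop (𝓝 0) := by
      have h1 : Tendsto (fun j => ENNReal.ofReal (5 * mesh d j)) atTop (𝓝 0) := by
        have := ENNReal.tendsto_ofReal ((tendsto_mesh d).const_mul 5)
        simpa using this
      have h2 := ENNReal.Tendsto.const_mul (a := (C₂ : ℝ≥0∞)) h1 (Or.inr ENNReal.coe_ne_top)
      have h3 := ENNReal.Tendsto.const_mul (a := (r : ℝ≥0∞)) h2 (Or.inr ENNReal.coe_ne_top)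
      have h4 := ENNReal.Tendsto.const_mul (a := D) h3 (Or.inr hDtop)
      have h5 := ENNReal.Tendsto.const_mul (a := D) h4 (Or.inr hDtop)
      simpa only [mul_zero] using h5
    have hE : ∀ j, P {ω | ∃ l ∈ F j, l.Nodup ∧ ∀ c ∈ l, c ∈ occ L j ω} ≤ b j := by
      intro j
      refine (hL.measure_exists_list_le j 3 (F j) (hF3 j)).trans ?_
      obtain ⟨N₁, h1, h1'⟩ := hC₁ j ((K : ℝ) + d) (by positivity)
      obtain ⟨N₂, h2, h2'⟩ := hC₂ j (4 * mesh d j) (mul_nonneg (by norm_num) (mesh_nonneg d j))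
      have hS1 : (S j).card ≤ N₁ := h1 0 0 le_rfl (by simp)
      have hFc : (F j).card ≤ N₁ * (N₁ * N₂) := by
        refine (Finset.card_biUnion_le_card_mul _ _ (N₁ * N₂) fun c₁ hc₁ => ?_).trans
          (Nat.mul_le_mul_right _ hS1)
        refine (Finset.card_biUnion_le_card_mul _ _ N₂ fun c₂ hc₂ => ?_).trans
          (Nat.mul_le_mul_right _ hS1)
        refine Finset.card_image_le.trans (h2 _ _ dist_nonneg ?_)
        have a1 := (abs_le.1 (mem_gridAnnulus.1
          ((finite_gridAnnulus _ _ _ _).mem_toFinset.1 hc₁))).2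
        have a2 := (abs_le.1 (mem_gridAnnulus.1
          ((finite_gridAnnulus _ _ _ _).mem_toFinset.1 hc₂))).2
        have a3 : gridDist j c₁ c₂ ≤ gridDist j 0 c₁ + gridDist j 0 c₂ := by
          unfold gridDist
          exact dist_triangle_left _ _ _
        linarith [mesh_le d j]
      calc ((F j).card : ℝ≥0∞) * (r * v j) ^ 3
          ≤ ((N₁ * (N₁ * N₂) : ℕ) : ℝ≥0∞) * (r * v j) ^ 3 := by gcongr
        _ = (r * (N₁ * v j)) * ((r * (N₁ * v j)) * (r * (N₂ * v j))) := by
          push_cast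
          ring
        _ ≤ b j := by
          have e1 : r * (N₁ * v j) ≤ D := by
            refine mul_le_mul_right (h1'.trans ?_) _
            gcongr
            exact mesh_le d j
          have e2 : r * (N₂ * v j) ≤ r * (C₂ * ENNReal.ofReal (5 * mesh d j)) := by
            refine mul_le_mul_right (h2'.trans_eq ?_) _
            congr 2
            ring
          exact mul_le_mul' e1 (mul_le_mul' e1 e2)
    have hA : P {ω | ¬ ¬ ∃ l : List (EuclideanSpace ℝ (Fin d)), ∃ x y z,
        l = [x, y, z] ∧ l.Nodup ∧ dist x y = dist x z ∧
          ∀ u ∈ l, u ∈ L ω ∩ Metric.closedBall 0 K} ≤ 0 := by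
      refine le_of_forall_gt_imp_ge_of_dense fun ε hε => ?_
      refine measure_le_of_eventually (E := fun j =>
        {ω | ∃ l ∈ F j, l.Nodup ∧ ∀ c ∈ l, c ∈ occ L j ω}) (ae_of_all _ fun ω hω => ?_)
        ((hb0.eventually_le_const hε).mono fun j hj => (hE j).trans hj)
      obtain ⟨l, x, y, z, hl, hnd, hxyz, hmem⟩ := not_not.1 hω
      have hinj := isApprox_cell.eventually_injOn (κ := cell) (Z := {u | u ∈ l}) l.finite_toSet
      filter_upwards [hinj] with j hj
      have hx := hmem x (by simp [hl])
      have hy := hmem y (by simp [hl])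
      have hz := hmem z (by simp [hl])
      refine ⟨l.map (cell j), ?_, ?_, ?_⟩
      · simp only [F, Finset.mem_biUnion, Finset.mem_image, hl]
        refine ⟨cell j x, (finite_gridAnnulus _ _ _ _).mem_toFinset.2 (cell_mem_gridAnnulus j hx.2),
          cell j y, (finite_gridAnnulus _ _ _ _).mem_toFinset.2 (cell_mem_gridAnnulus j hy.2),
          cell j z, (finite_gridAnnulus _ _ _ _).mem_toFinset.2 ?_, rfl⟩
        have a1 := abs_le.1 (isApprox_cell.abs_sub_le j x y)
        have a2 := abs_le.1 (isApprox_cell.abs_sub_le j x z)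
        rw [mem_gridAnnulus, abs_le]
        constructor <;> linarith [a1.1, a1.2, a2.1, a2.2]
      · exact List.Nodup.map_on (fun a ha b hb hab => hj ha hb hab) hnd
      · intro c hc
        obtain ⟨u, hu, rfl⟩ := List.mem_map.1 hc
        exact mem_image_of_mem _ (hmem u hu).1
    rw [ae_iff]
    exact le_antisymm hA (zero_le)
  filter_upwards [ae_all_iff.2 main] with ω hω x hx y hy z hz hyz heq
  obtain ⟨K, hK⟩ := exists_nat_ge (max (dist x 0) (max (dist y 0) (dist z 0)))
  have hxy : x ≠ y := by
    rintro rfl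
    rw [dist_self] at heq
    exact hyz (dist_eq_zero.1 heq.symm)
  have hxz : x ≠ z := by
    rintro rfl
    rw [dist_self] at heq
    exact hxy (dist_eq_zero.1 heq)
  refine hω K ⟨[x, y, z], x, y, z, rfl, by simp [hxy, hxz, hyz], heq, ?_⟩
  simp only [max_le_iff] at hK
  simp [hx, hy, hz, hK.1, hK.2.1, hK.2.2, -dist_zero_right, Metric.mem_closedBall]

end Scalene

section NoLongPath

variable {d : ℕ} {Ω : Type*} [MeasurableSpace Ω] {P : Measure Ω} {r : ℝ≥0}
  {L : Ω → Set (EuclideanSpace ℝ (Fin d))}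

/-- The first-moment bound for self-avoiding paths with step lengths near `q`: if the annuli of grid
cubes at distance about `q` contain at most half an occupied cube on average, long paths are
exponentially unlikely. -/
theorem IsPoissonProcess.measure_long_path_le (hL : IsPoissonProcess P r L)
    {N₁ N₂ : ℕ → ℕ} {K q h : ℝ} {D : ℝ≥0∞}
    (hh : 0 < h)
    (h1 : ∀ j, (finite_gridAnnulus (d := d) j 0 0 (K + d)).toFinset.card ≤ N₁ j)
    (h1' : ∀ j, r * (N₁ j * ENNReal.ofReal ((1 / 2 ^ j) ^ d)) ≤ D)
    (h2 : ∀ j c₀, (finite_gridAnnulus (d := d) j c₀ q (2 * h)).toFinset.card ≤ N₂ j)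
    (h2' : ∀ᶠ j in atTop, r * (N₂ j * ENNReal.ofReal ((1 / 2 ^ j) ^ d)) ≤ 2⁻¹) (n : ℕ) :
    P {ω | ∃ x ∈ L ω ∩ Metric.closedBall 0 K, ∃ l : List (EuclideanSpace ℝ (Fin d)),
      (x :: l).Nodup ∧ (x :: l).IsChain (fun a b => |dist a b - q| ≤ h) ∧
        (∀ y ∈ x :: l, y ∈ L ω) ∧ l.length = n} ≤ D * 2⁻¹ ^ n := by
  set v : ℕ → ℝ≥0∞ := fun j => ENNReal.ofReal ((1 / 2 ^ j) ^ d) with hv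
  let N : ℕ → (Fin d → ℤ) → Finset (Fin d → ℤ) := fun j c =>
    (finite_gridAnnulus j c q (2 * h)).toFinset
  let F : ℕ → Finset (List (Fin d → ℤ)) := fun j =>
    (finite_gridAnnulus j 0 0 (K + d)).toFinset.biUnion fun c => pathsFrom (N j) n c
  have hFl : ∀ j, ∀ l ∈ F j, l.length = n + 1 := by
    intro j l hl
    obtain ⟨c, _, hc⟩ := Finset.mem_biUnion.1 hl
    exact length_of_mem_pathsFrom hc
  have hE : ∀ᶠ j in atTop, P {ω | ∃ l ∈ F j, l.Nodup ∧ ∀ c ∈ l, c ∈ occ L j ω} ≤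
      D * 2⁻¹ ^ n := by
    filter_upwards [h2'] with j hj
    refine (hL.measure_exists_list_le j (n + 1) (F j) (hFl j)).trans ?_
    have hFc : (F j).card ≤ N₁ j * N₂ j ^ n :=
      (Finset.card_biUnion_le_card_mul _ _ (N₂ j ^ n) fun c _ =>
        card_pathsFrom_le (h2 j) n c).trans (Nat.mul_le_mul_right _ (h1 j))
    calc ((F j).card : ℝ≥0∞) * (r * v j) ^ (n + 1)
        ≤ ((N₁ j * N₂ j ^ n : ℕ) : ℝ≥0∞) * (r * v j) ^ (n + 1) := by gcongr
      _ = (r * (N₁ j * v j)) * (r * (N₂ j * v j)) ^ n := by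
        push_cast
        ring
      _ ≤ D * 2⁻¹ ^ n := mul_le_mul' (h1' j) (pow_le_pow_left' hj n)
  refine measure_le_of_eventually (E := fun j =>
    {ω | ∃ l ∈ F j, l.Nodup ∧ ∀ c ∈ l, c ∈ occ L j ω}) (ae_of_all _ fun ω hω => ?_) hE
  obtain ⟨x, hx, l, hnd, hch, hmem, hlen⟩ := hω
  have hinj := isApprox_cell.eventually_injOn (κ := cell) (Z := {u | u ∈ x :: l})
    (x :: l).finite_toSet
  have hsmall := (isApprox_cell (d := d)).tendsto.eventually_lt_const hh
  filter_upwards [hinj, hsmall] with j hj hjh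
  refine ⟨(x :: l).map (cell j), ?_, ?_, ?_⟩
  · refine Finset.mem_biUnion.2 ⟨cell j x, (finite_gridAnnulus _ _ _ _).mem_toFinset.2
      (cell_mem_gridAnnulus j hx.2), ?_⟩
    have hch' : ((x :: l).map (cell j)).IsChain (fun a b => b ∈ N j a) := by
      rw [List.isChain_map]
      refine hch.imp fun a b hab => ?_
      refine (finite_gridAnnulus _ _ _ _).mem_toFinset.2 ?_
      have a1 := abs_le.1 (isApprox_cell.abs_sub_le j a b)
      have a2 := abs_le.1 hab
      rw [mem_gridAnnulus, abs_le]
      constructor <;> linarith [a1.1, a1.2, a2.1, a2.2]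
    rw [List.map_cons] at hch' ⊢
    have := mem_pathsFrom hch'
    rwa [List.length_map, hlen] at this
  · exact List.Nodup.map_on (fun a ha b hb hab => hj ha hb hab) hnd
  · intro c hc
    obtain ⟨u, hu, rfl⟩ := List.mem_map.1 hc
    exact mem_image_of_mem _ (hmem u hu)

theorem IsPoissonProcess.exists_ae_no_long_path (hd : 1 ≤ d) (hL : IsPoissonProcess P r L)
    (R : ℕ) : ∃ h : ℝ, 0 < h ∧ ∀ q : ℚ, (0 : ℝ) ≤ q → (q : ℝ) ≤ R → ∀ᵐ ω ∂P, ∀ x ∈ L ω, ∃ n : ℕ,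
      ∀ l : List (EuclideanSpace ℝ (Fin d)), (x :: l).Nodup →
        (x :: l).IsChain (fun a b => |dist a b - q| ≤ h) → (∀ y ∈ x :: l, y ∈ L ω) →
          l.length ≠ n := by
  obtain ⟨C₂, hC₂⟩ := exists_card_gridAnnulus_le_nat hd ((R : ℝ) + 2)
  -- With this `h`, the width `3 * h` of the grid annuli satisfies `r * C₂ * (3 * h) ≤ 1 / 2`.
  set h : ℝ := min 1 (1 / (6 * (r * C₂ + 1))) with hhdef
  have hpos : (0 : ℝ) < 6 * (r * C₂ + 1) := by positivity
  have hh : 0 < h := lt_min one_pos (by positivity)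
  have hh1 : h ≤ 1 := min_le_left _ _
  have hh2 : h ≤ 1 / (6 * (r * C₂ + 1)) := min_le_right _ _
  choose N₂ hN₂ hN₂' using fun j => hC₂ j (2 * h) (by positivity)
  refine ⟨h, hh, fun q hq hqR => ?_⟩
  have h2' : ∀ᶠ j in atTop, r * (N₂ j * ENNReal.ofReal ((1 / 2 ^ j) ^ d)) ≤ 2⁻¹ := by
    filter_upwards [(tendsto_mesh d).eventually_lt_const hh] with j hj
    calc r * (N₂ j * ENNReal.ofReal ((1 / 2 ^ j) ^ d))
        ≤ r * (C₂ * ENNReal.ofReal (3 * h)) := by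
          refine mul_le_mul_right ((hN₂' j).trans ?_) _
          gcongr
          linarith
      _ = ENNReal.ofReal (r * (C₂ * (3 * h))) := by
          rw [ENNReal.ofReal_mul (p := (r : ℝ)) (by positivity),
            ENNReal.ofReal_mul (p := (C₂ : ℝ)) (by positivity),
            ENNReal.ofReal_coe_nnreal, ENNReal.ofReal_coe_nnreal]
      _ ≤ ENNReal.ofReal (2⁻¹) := by
          refine ENNReal.ofReal_le_ofReal ?_
          rw [le_div_iff₀ hpos] at hh2
          have : h * (6 * (r * C₂)) ≤ h * (6 * (r * C₂ + 1)) := by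
            gcongr
            linarith
          linarith
      _ = 2⁻¹ := by
          rw [ENNReal.ofReal_inv_of_pos two_pos]
          simp
  have main : ∀ K : ℕ, ∀ᵐ ω ∂P, ∀ x ∈ L ω ∩ Metric.closedBall 0 K, ∃ n : ℕ,
      ∀ l : List (EuclideanSpace ℝ (Fin d)), (x :: l).Nodup →
        (x :: l).IsChain (fun a b => |dist a b - q| ≤ h) → (∀ y ∈ x :: l, y ∈ L ω) →
          l.length ≠ n := by
    intro K
    obtain ⟨C₁, hC₁⟩ := exists_card_gridAnnulus_le_nat hd ((K : ℝ) + d)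
    choose N₁ hN₁ hN₁' using fun j => hC₁ j ((K : ℝ) + d) (by positivity)
    set D : ℝ≥0∞ := r * (C₁ * ENNReal.ofReal ((K : ℝ) + d + d)) with hD
    have hDtop : D ≠ ∞ := by finiteness
    have hbd := hL.measure_long_path_le (N₁ := N₁) (N₂ := N₂) (K := K) (q := q) (h := h) (D := D)
      hh (fun j => hN₁ j 0 0 le_rfl (by simp)) (fun j => by
        refine mul_le_mul_right ((hN₁' j).trans ?_) _
        gcongr
        exact mesh_le d j) (fun j c₀ => hN₂ j c₀ q hq (by linarith)) h2'
    refine ae_of_forall_measure_le (b := fun n => D * 2⁻¹ ^ n) ?_ fun n =>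
      (measure_mono fun ω hω => ?_).trans (hbd n)
    · have := ENNReal.Tendsto.const_mul (a := D)
        (ENNReal.tendsto_pow_atTop_nhds_zero_of_lt_one (r := 2⁻¹) (by simp)) (Or.inr hDtop)
      simpa only [mul_zero] using this
    · have hω' := not_forall.1 hω
      obtain ⟨x, hx⟩ := hω'
      simp only [not_forall, not_exists, exists_prop, not_not] at hx
      obtain ⟨hx, hxn⟩ := hx
      obtain ⟨l, hl⟩ := hxn n
      exact ⟨x, hx, l, by simpa [ne_eq, not_not] using hl⟩
  filter_upwards [ae_all_iff.2 main] with ω hω x hx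
  obtain ⟨K, hK⟩ := exists_nat_ge (dist x 0)
  exact hω K x ⟨hx, hK⟩

theorem IsPoissonProcess.ae_isGeneric (hd : 1 ≤ d) (hL : IsPoissonProcess P r L) :
    ∀ᵐ ω ∂P, IsGeneric (L ω) := by
  choose h hh hp using hL.exists_ae_no_long_path hd
  have hp' : ∀ᵐ ω ∂P, ∀ (R : ℕ) (q : ℚ), (0 : ℝ) ≤ q → (q : ℝ) ≤ R → ∀ x ∈ L ω, ∃ n : ℕ,
      ∀ l : List (EuclideanSpace ℝ (Fin d)), (x :: l).Nodup →
        (x :: l).IsChain (fun a b => |dist a b - q| ≤ h R) → (∀ y ∈ x :: l, y ∈ L ω) →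
          l.length ≠ n := by
    rw [ae_all_iff]
    intro R
    rw [ae_all_iff]
    intro q
    by_cases hq : (0 : ℝ) ≤ q ∧ (q : ℝ) ≤ R
    · filter_upwards [hp R q hq.1 hq.2] with ω hω _ _ using hω
    · exact ae_of_all _ fun ω h1 h2 => (hq ⟨h1, h2⟩).elim
  filter_upwards [hL.ae_finite, hL.ae_scalene hd, hp'] with ω h1 h2 h3
  exact ⟨h1, h2, wellFounded_desc h1 fun R => ⟨h R, hh R, h3 R⟩⟩

end NoLongPath

/-! ### Measurability and invariance of the approximations -/

section Invariance

theorem measurableSet_encard_lt {α ι : Type*} [MeasurableSpace α] [Countable ι] {Q : α → ι → Prop}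
    (hQ : ∀ z, MeasurableSet {a | Q a z}) (m : ℕ) :
    MeasurableSet {a | {z | Q a z}.encard < m} := by
  have e : {a | {z | Q a z}.encard < m} = (⋃ s ∈ {s : Finset ι | s.card = m},
      ⋂ z ∈ s, {a | Q a z})ᶜ := by
    ext a
    simp only [mem_ofPred_eq, mem_compl_iff, mem_iUnion, mem_iInter, exists_prop, not_exists,
      not_and]
    constructor
    · intro h s hs hsub
      have := encard_le_encard (show (s : Set ι) ⊆ {z | Q a z} from fun z hz => hsub z hz)
      rw [encard_coe_eq_coe_finsetCard, hs] at this
      exact not_lt.2 this h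
    · intro h
      by_contra hcon
      obtain ⟨t, hts, htc⟩ := exists_subset_encard_eq (not_lt.1 hcon)
      have htf := finite_of_encard_eq_coe htc
      refine h htf.toFinset ?_ fun z hz => hts (htf.mem_toFinset.1 hz)
      rw [htf.encard_eq_coe_toFinset_card] at htc
      exact_mod_cast htc
  rw [e]
  exact (MeasurableSet.biUnion (to_countable _) fun s _ =>
    s.measurableSet_biInter fun z _ => hQ z).compl

theorem measurableSet_mem {ι : Type*} (c : ι) : MeasurableSet {O : ι → Prop | O c} :=
  measurableSet_setOfPred.2 (measurable_pi_apply c)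

theorem measurableSet_truncAdj {X : Type*} [Countable X] (ρ : X → X → ℝ) (m : ℕ) (t : ℕ) :
    ∀ x y : X, MeasurableSet {O : X → Prop | truncAdj ρ m {c | O c} t x y} := by
  induction t with
  | zero => exact fun x y => by simp [truncAdj]
  | succ t ih =>
    intro x y
    have key : ∀ u v : X, MeasurableSet
        {O : X → Prop | {z | truncAdj ρ m {c | O c} t u z ∧ ρ u z < ρ u v}.encard < m} :=
      fun u v => measurableSet_encard_lt (fun z => (ih u z).inter (MeasurableSet.const _)) m
    exact (measurableSet_mem x).inter ((measurableSet_mem y).inter ((MeasurableSet.const _).inter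
      ((key x y).inter (key y x))))

theorem measurableSet_hasDeficient {X : Type*} [Countable X] (ρ : X → X → ℝ) (m : ℕ) (K : ℝ)
    (t : ℕ) (W : Set X) : MeasurableSet {O : X → Prop | HasDeficient ρ m K t {c | O c} W} := by
  have e : {O : X → Prop | HasDeficient ρ m K t {c | O c} W} = ⋃ w ∈ W, {O : X → Prop | O w} ∩
      {O : X → Prop | {y | truncAdj ρ m {c | O c} t w y ∧ ρ w y ≤ K}.encard < m} := by
    ext O
    simp only [HasDeficient, mem_ofPred_eq, mem_inter_iff, mem_iUnion, exists_prop]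
    exact ⟨fun ⟨w, ⟨h1, h2⟩, h3⟩ => ⟨w, h2, h1, h3⟩, fun ⟨w, h2, h1, h3⟩ => ⟨w, ⟨h1, h2⟩, h3⟩⟩
  rw [e]
  exact MeasurableSet.biUnion (to_countable _) fun w _ => (measurableSet_mem w).inter
    (measurableSet_encard_lt (fun z => (measurableSet_truncAdj ρ m t w z).inter
      (MeasurableSet.const _)) m)

/-- The truncated recursion is invariant under isometries. -/
theorem truncAdj_preimage {X Y : Type*} (e : X ≃ Y) {ρ : X → X → ℝ} {ρ' : Y → Y → ℝ}
    (hρ : ∀ x y, ρ' (e x) (e y) = ρ x y) (m : ℕ) (O : Set Y) (t : ℕ) :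
    ∀ x y, truncAdj ρ m (e ⁻¹' O) t x y ↔ truncAdj ρ' m O t (e x) (e y) := by
  induction t with
  | zero => exact fun x y => Iff.rfl
  | succ t ih =>
    intro x y
    have key : ∀ u v : X, {z | truncAdj ρ m (e ⁻¹' O) t u z ∧ ρ u z < ρ u v}.encard =
        {z | truncAdj ρ' m O t (e u) z ∧ ρ' (e u) z < ρ' (e u) (e v)}.encard := by
      intro u v
      rw [← e.injective.encard_image]
      congr 1
      ext z
      obtain ⟨z, rfl⟩ := e.surjective z
      simp [ih, hρ]
    simp only [truncAdj, key, mem_preimage, ne_eq, e.injective.eq_iff]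

theorem hasDeficient_preimage {X Y : Type*} (e : X ≃ Y) {ρ : X → X → ℝ} {ρ' : Y → Y → ℝ}
    (hρ : ∀ x y, ρ' (e x) (e y) = ρ x y) (m : ℕ) (K : ℝ) (t : ℕ) (O W : Set Y) :
    HasDeficient ρ m K t (e ⁻¹' O) (e ⁻¹' W) ↔ HasDeficient ρ' m K t O W := by
  have key : ∀ w : X, {y | truncAdj ρ m (e ⁻¹' O) t w y ∧ ρ w y ≤ K}.encard =
      {y | truncAdj ρ' m O t (e w) y ∧ ρ' (e w) y ≤ K}.encard := by
    intro w
    rw [← e.injective.encard_image]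
    congr 1
    ext z
    obtain ⟨z, rfl⟩ := e.surjective z
    simp [truncAdj_preimage e hρ, hρ]
  simp only [HasDeficient, e.surjective.exists, key, ← preimage_inter, mem_preimage]

variable {d : ℕ} {Ω : Type*} [MeasurableSpace Ω] {P : Measure Ω} {r : ℝ≥0}
  {L : Ω → Set (EuclideanSpace ℝ (Fin d))}

/-- The occupation field is invariant in law under shifts of the grid. -/
theorem IsPoissonProcess.map_occ_shift (hL : IsPoissonProcess P r L) (j : ℕ)
    (s : Fin d → ℤ) : P.map (fun ω (c : Fin d → ℤ) => c + s ∈ occ L j ω) =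
      P.map (fun ω c => c ∈ occ L j ω) := by
  have h0 := hL.iIndepFun_occ j
  have h1 := h0.precomp (add_left_injective s)
  rw [h0.map_fun_eq_infinitePi_map₀' (hL.aemeasurable_occ j),
    h1.map_fun_eq_infinitePi_map₀' (fun c => hL.aemeasurable_occ j (c + s))]
  congr 1
  ext1 c
  exact hL.map_occ j _ _

theorem IsPoissonProcess.aemeasurable_occ_pi (hL : IsPoissonProcess P r L) (j : ℕ) :
    AEMeasurable (fun ω (c : Fin d → ℤ) => c ∈ occ L j ω) P :=
  aemeasurable_pi_iff.2 (hL.aemeasurable_occ j)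

theorem IsPoissonProcess.nullMeasurableSet_hasDeficient (hL : IsPoissonProcess P r L) (m : ℕ)
    (K : ℝ) (j : ℕ) (W : Set (Fin d → ℤ)) :
    NullMeasurableSet {ω | HasDeficient (gridDist j) m K j (occ L j ω) W} P :=
  (hL.aemeasurable_occ_pi j).nullMeasurableSet_preimage
    (measurableSet_hasDeficient (gridDist j) m K j W)

theorem IsPoissonProcess.measure_hasDeficient_shift (hL : IsPoissonProcess P r L) (m : ℕ)
    (K : ℝ) (j : ℕ) (W : Set (Fin d → ℤ)) (s : Fin d → ℤ) :
    P {ω | HasDeficient (gridDist j) m K j (occ L j ω) W} =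
      P {ω | HasDeficient (gridDist j) m K j (occ L j ω) {c | c + s ∈ W}} := by
  have hm := measurableSet_hasDeficient (gridDist j) m K j {c : Fin d → ℤ | c + s ∈ W}
  have h1 := Measure.map_apply_of_aemeasurable (hL.aemeasurable_occ_pi j) hm
  have hae : AEMeasurable (fun ω (c : Fin d → ℤ) => c + s ∈ occ L j ω) P :=
    aemeasurable_pi_iff.2 fun c => hL.aemeasurable_occ j (c + s)
  have h2 := Measure.map_apply_of_aemeasurable hae hm
  rw [hL.map_occ_shift j s, h1] at h2
  refine Eq.trans ?_ h2.symm
  congr 1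
  ext ω
  exact (hasDeficient_preimage (Equiv.addRight s) (fun x y => gridDist_add j x y s) m K j
    (occ L j ω) W).symm

/-- The cubes of the grid of mesh `2⁻ʲ` that are contained in the unit cube with index `c`. -/
def window (j : ℕ) (c : Fin d → ℤ) : Set (Fin d → ℤ) := {a | ∀ i, a i / 2 ^ j = c i}

theorem cell_mem_window_iff (j : ℕ) (c : Fin d → ℤ) (x : EuclideanSpace ℝ (Fin d)) :
    cell j x ∈ window j c ↔ x ∈ cube 0 c := by
  simp only [window, mem_ofPred_eq, cell_zero_eq, cube, funext_iff]

theorem isBounded_cube (c : Fin d → ℤ) : Bornology.IsBounded (cube 0 c) := by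
  refine (Metric.isBounded_closedBall (x := node 0 c) (r := mesh d 0)).subset fun x hx => ?_
  have h := dist_node_cell_le 0 x
  rw [show cell 0 x = c from hx] at h
  rwa [Metric.mem_closedBall, dist_comm]

theorem IsPoissonProcess.measure_hasDeficient_window (hL : IsPoissonProcess P r L) (m : ℕ)
    (K : ℝ) (j : ℕ) (c s : Fin d → ℤ) :
    P {ω | HasDeficient (gridDist j) m K j (occ L j ω) (window j (c + s))} =
      P {ω | HasDeficient (gridDist j) m K j (occ L j ω) (window j c)} := by
  rw [hL.measure_hasDeficient_shift m K j (window j (c + s)) (fun i => s i * 2 ^ j)]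
  congr 1
  ext ω
  have : {a : Fin d → ℤ | (a + fun i => s i * 2 ^ j) ∈ window j (c + s)} = window j c := by
    ext a
    simp only [window, mem_ofPred_eq, Pi.add_apply]
    refine forall_congr' fun i => ?_
    rw [Int.add_mul_ediv_right _ _ (by positivity), add_left_inj]
  rw [this]

/-! ### The stable matching is almost surely perfect -/

open Classical in
/-- Of `n` translates of a unit cube, at most `m + 1` contain a point with fewer than `m` partners
within a large distance. The approximating events for different translates have equal probability,
and dominated convergence bounds its limit. -/
theorem IsPoissonProcess.mul_measure_deficient_le [IsProbabilityMeasure P] (hd : 1 ≤ d)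
    (hL : IsPoissonProcess P r L) {m : ℕ} {A : Ω → EuclideanSpace ℝ (Fin d) →
      EuclideanSpace ℝ (Fin d) → Prop} (hA : ∀ᵐ ω ∂P, IsGreedy (L ω) m (A ω))
    (c : Fin d → ℤ) (n : ℕ) :
    n * P {ω | ∃ x ∈ L ω, x ∈ cube 0 c ∧ {y | A ω x y}.encard < m} ≤ m + 1 := by
  have hgen := hL.ae_isGeneric hd
  set B : ℕ → Set (EuclideanSpace ℝ (Fin d)) := fun i => cube 0 (c + fun _ => (i : ℤ)) with hB
  have hBdisj : ∀ i ∈ Finset.range n, ∀ j ∈ Finset.range n, i ≠ j → Disjoint (B i) (B j) := by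
    intro i _ j _ hij
    refine disjoint_cube 0 fun h => hij ?_
    have := congr_fun h ⟨0, by omega⟩
    simpa using this
  have hU : Bornology.IsBounded (⋃ i ∈ Finset.range n, B i) :=
    (Bornology.isBounded_biUnion_finset _).2 fun i _ => isBounded_cube _
  obtain ⟨K, hK⟩ : ∃ K, ∀ i ∈ Finset.range n, ∀ j ∈ Finset.range n, ∀ x ∈ B i, ∀ y ∈ B j,
      dist x y < K := by
    obtain ⟨K, hK⟩ := Metric.isBounded_iff.1 hU
    refine ⟨K + 1, fun i hi j hj x hx y hy => ?_⟩
    have := hK (mem_iUnion₂.2 ⟨i, hi, hx⟩) (mem_iUnion₂.2 ⟨j, hj, hy⟩)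
    linarith
  set V : ℕ → ℕ → Set Ω := fun i j => {ω | HasDeficient (gridDist j) m K j (occ L j ω)
    (window j (c + fun _ => (i : ℤ)))} with hV
  have hVm : ∀ i j, NullMeasurableSet (V i j) P := fun i j =>
    hL.nullMeasurableSet_hasDeficient m K j _
  have hVP : ∀ i j, P (V i j) = P (V 0 j) := by
    intro i j
    rw [hV]
    simp only
    rw [hL.measure_hasDeficient_window m K j c, hL.measure_hasDeficient_window m K j c]
  have hW : ∀ i j x, cell j x ∈ window j (c + fun _ => ((i : ℕ) : ℤ)) ↔ x ∈ B i :=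
    fun i j x => cell_mem_window_iff j _ x
  have hcard : ∀ᵐ ω ∂P, ∀ᶠ j in atTop,
      ((Finset.range n).filter fun i => ω ∈ V i j).card ≤ m + 1 := by
    filter_upwards [hgen, hA] with ω h1 h2
    exact isApprox_cell.eventually_card_hasDeficient_le h1 h2 (Finset.range n) B
      (fun i j => window j (c + fun _ => (i : ℤ))) hW (fun i => isBounded_cube _) hBdisj hK
  have hU0 : ∀ᵐ ω ∂P, ω ∈ {ω | ∃ x ∈ L ω, x ∈ cube 0 c ∧ {y | A ω x y}.encard < m} →
      ∀ᶠ j in atTop, ω ∈ V 0 j := by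
    filter_upwards [hgen, hA] with ω h1 h2
    rintro ⟨x, hx, hxc, hdef⟩
    refine isApprox_cell.eventually_hasDeficient h1 h2 (B := B 0)
      (W := fun j => window j (c + fun _ => ((0 : ℕ) : ℤ))) (hW 0) K hx ?_ hdef
    have : c + (fun _ => ((0 : ℕ) : ℤ)) = c := by
      ext i
      simp
    simpa only [hB, this] using hxc
  -- The number of deficient windows is eventually at most `m + 1`, so its maximum with `m + 1`
  -- converges to `m + 1` almost surely.
  let f : ℕ → Ω → ℝ≥0∞ := fun j ω =>
    max (∑ i ∈ Finset.range n, (V i j).indicator 1 ω) (m + 1)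
  have hsum : ∀ j ω, ∑ i ∈ Finset.range n, (V i j).indicator (1 : Ω → ℝ≥0∞) ω =
      (((Finset.range n).filter fun i => ω ∈ V i j).card : ℝ≥0∞) := by
    intro j ω
    rw [Finset.card_filter]
    push_cast
    exact Finset.sum_congr rfl fun i _ => by simp [indicator_apply]
  have hsm : ∀ j, AEMeasurable (fun ω => ∑ i ∈ Finset.range n, (V i j).indicator (1 : Ω → ℝ≥0∞) ω)
      P := fun j => Finset.aemeasurable_fun_sum _ fun i _ => aemeasurable_one.indicator₀ (hVm i j)
  have hlim : Tendsto (fun j => ∫⁻ ω, f j ω ∂P) atTop (𝓝 (∫⁻ _, ((m : ℝ≥0∞) + 1) ∂P)) := by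
    refine tendsto_lintegral_of_dominated_convergence' (fun _ => max (n : ℝ≥0∞) (m + 1))
      (fun j => (hsm j).max aemeasurable_const) (fun j => ae_of_all _ fun ω => ?_) ?_ ?_
    · refine max_le_max ?_ le_rfl
      rw [hsum]
      exact_mod_cast (Finset.card_filter_le _ _).trans_eq (Finset.card_range n)
    · rw [lintegral_const, measure_univ, mul_one]
      exact (max_lt (ENNReal.natCast_lt_top n) (by finiteness)).ne
    · filter_upwards [hcard] with ω hω
      refine tendsto_const_nhds.congr' ?_
      filter_upwards [hω] with j hj
      refine (max_eq_right ?_).symm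
      rw [hsum]
      exact_mod_cast hj
  rw [lintegral_const, measure_univ, mul_one] at hlim
  have hle : ∀ j, n * P (V 0 j) ≤ ∫⁻ ω, f j ω ∂P := by
    intro j
    calc n * P (V 0 j) = ∑ i ∈ Finset.range n, P (V i j) := by
          simp [hVP]
      _ = ∑ i ∈ Finset.range n, ∫⁻ ω, (V i j).indicator 1 ω ∂P :=
          Finset.sum_congr rfl fun i _ => (lintegral_indicator_one₀ (hVm i j)).symm
      _ = ∫⁻ ω, ∑ i ∈ Finset.range n, (V i j).indicator 1 ω ∂P :=
          (lintegral_finsetSum' _ fun i _ => aemeasurable_one.indicator₀ (hVm i j)).symm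
      _ ≤ _ := lintegral_mono fun ω => le_max_left _ _
  rcases Nat.eq_zero_or_pos n with rfl | hn
  · simp
  have hn0 : (n : ℝ≥0∞) ≠ 0 := by exact_mod_cast hn.ne'
  refine le_of_forall_gt_imp_ge_of_dense fun b hb => ?_
  rw [mul_comm, ← ENNReal.le_div_iff_mul_le (Or.inl hn0) (Or.inl (ENNReal.natCast_ne_top n))]
  refine measure_le_of_eventually hU0 ?_
  filter_upwards [hlim.eventually_le_const hb] with j hj
  rw [ENNReal.le_div_iff_mul_le (Or.inl hn0) (Or.inl (ENNReal.natCast_ne_top n)), mul_comm]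
  exact (hle j).trans hj

theorem IsPoissonProcess.ae_full [IsProbabilityMeasure P] (hd : 1 ≤ d)
    (hL : IsPoissonProcess P r L) {m : ℕ} {A : Ω → EuclideanSpace ℝ (Fin d) →
      EuclideanSpace ℝ (Fin d) → Prop} (hA : ∀ᵐ ω ∂P, IsGreedy (L ω) m (A ω)) :
    ∀ᵐ ω ∂P, ∀ x ∈ L ω, (m : ℕ∞) ≤ {y | A ω x y}.encard := by
  have key : ∀ c : Fin d → ℤ, ∀ᵐ ω ∂P,
      ¬ ∃ x ∈ L ω, x ∈ cube 0 c ∧ {y | A ω x y}.encard < m := by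
    intro c
    rw [ae_iff]
    simp only [not_not]
    by_contra hne
    have h := hL.mul_measure_deficient_le hd hA c
    obtain ⟨n, hn⟩ := ENNReal.exists_nat_mul_gt hne (b := m + 1) (by finiteness)
    exact not_lt.2 (h n) hn
  filter_upwards [ae_all_iff.2 key] with ω hω x hx
  by_contra hcon
  exact hω (cell 0 x) ⟨x, hx, rfl, not_le.1 hcon⟩

end Invariance

end FriendlyFrogs

theorem mainTheorem11 {d : ℕ} (hd : 1 ≤ d) {Ω : Type*} [MeasurableSpace Ω] (P : Measure Ω)
    [IsProbabilityMeasure P] (r : ℝ≥0) (hr : 0 < r) (L : Ω → Set (EuclideanSpace ℝ (Fin d)))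
    (hL : FriendlyFrogs.IsPoissonProcess P r L) (k : ℕ) (hk : 1 ≤ k) :
    (∀ᵐ ω ∂P, FriendlyFrogs.IsWinForBob (L ω) k) ∧
    (∀ᵐ ω ∂P,
      (∃! M : SimpleGraph (EuclideanSpace ℝ (Fin d)),
        FriendlyFrogs.IsStableMultiMatching (L ω) (k + 1) M) ∧
      ∀ M : SimpleGraph (EuclideanSpace ℝ (Fin d)),
        FriendlyFrogs.IsStableMultiMatching (L ω) (k + 1) M →
          FriendlyFrogs.IsPerfect (L ω) (k + 1) M) := by
  have hgen := hL.ae_isGeneric hd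
  have hex : ∀ ω, ∃ M : SimpleGraph (EuclideanSpace ℝ (Fin d)),
      FriendlyFrogs.IsGeneric (L ω) → FriendlyFrogs.IsStableMultiMatching (L ω) (k + 1) M := by
    intro ω
    by_cases h : FriendlyFrogs.IsGeneric (L ω)
    · obtain ⟨M, hM, -⟩ := h.existsUnique_stable (k + 1)
      exact ⟨M, fun _ => hM⟩
    · exact ⟨⊥, fun h' => (h h').elim⟩
  choose M hM using hex
  have hfull := hL.ae_full hd (m := k + 1) (A := fun ω => (M ω).Adj)
    (hgen.mono fun ω h => (hM ω h).isGreedy h)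
  have hperf : ∀ᵐ ω ∂P, FriendlyFrogs.IsPerfect (L ω) (k + 1) (M ω) := by
    filter_upwards [hgen, hfull] with ω h1 h2 x hx
    exact le_antisymm ((hM ω h1).1.2 x hx) (h2 x hx)
  constructor
  · filter_upwards [hgen, hperf] with ω h1 h2
    exact FriendlyFrogs.isWinForBob_of_isPerfect h1 (hM ω h1) h2
  · filter_upwards [hgen, hperf] with ω h1 h2
    refine ⟨h1.existsUnique_stable (k + 1), fun M' hM' => ?_⟩
    rw [(h1.existsUnique_stable (k + 1)).unique hM' (hM ω h1)]
    exact h2
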